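/- Let $n\ge 1$. Let $\mathrm{Conv}_{\rm c}(\mathbb{R}^n)$ be the class of convex, lower semicontinuous functions $\psi:\mathbb{R}^n\to(-\infty,+\infty]$ with $\psi\not\equiv+\infty$ and $\lim_{\|x\|\to\infty}\psi(x)=+\infty$, and let $\mathrm{LC}_{\rm c}(\mathbb{R}^n)=\{e^{-\psi}:\psi\in\mathrm{Conv}_{\rm c}(\mathbb{R}^n)\}$. For a unit vector $u$ put $R_u(x)=x-2\langle x,u\rangle u$ and let the Minkowski symmetral of $\psi\in\mathrm{Conv}_{\rm c}(\mathbb{R}^n)$ be $$(\tau_u\psi)(x)=\inf_{y+z=x}\left\{\tfrac12\psi(2y)+\tfrac12\psi(R_u(2z))\right\}.$$ A sequence $\psi_j$ epi-converges to $\varphi$ if for every $x\in\mathbb{R}^n$ one has $\varphi(x)\le\liminf_j\psi_j(x_j)$ for every sequence $x_j\to x$, and $\varphi(x)=\lim_j\psi_j(x_j)$ for at least one sequence $x_j\to x$. For $f=e^{-\psi}\in\mathrm{LC}_{\rm c}(\mathbb{R}^n)$, a hypo-symmetrization of $f$ is a function $f_{\rm sym}=e^{-\psi_{\rm sym}}$,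 where $\psi_{\rm sym}\in\mathrm{Conv}_{\rm c}(\mathbb{R}^n)$ is invariant under all linear isometries of $\mathbb{R}^n$ and there are unit vectors $u_1,u_2,\ldots$ such that $\tau_{u_m}\cdots\tau_{u_1}\psi$ epi-converges to $\psi_{\rm sym}$ as $m\to\infty$. Then for every $f\in\mathrm{LC}_{\rm c}(\mathbb{R}^n)$: $f$ is integrable, $f$ has a hypo-symmetrization, and every hypo-symmetrization $f_{\rm sym}$ of $f$ is integrable and satisfies $$J(f)\le J(f_{\rm sym}),\qquad\text{where } J(g)=\int_{\mathbb{R}^n}g(x)\,dx .$$ -/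

import Mathlib

open Filter Topology MeasureTheory

noncomputable section

namespace HypoSym

/-- Convexity of an extended-real-valued function, through its epigraph. -/
def ConvexFun {n : ℕ} (ψ : EuclideanSpace ℝ (Fin n) → EReal) : Prop :=
  Convex ℝ {p : EuclideanSpace ℝ (Fin n) × ℝ | ψ p.1 ≤ (p.2 : EReal)}

/-- The class `Conv_c(ℝⁿ)`: convex, proper, lower semicontinuous, coercive functions
`ψ : ℝⁿ → (-∞, +∞]`. -/
structure IsConvC {n : ℕ} (ψ : EuclideanSpace ℝ (Fin n) → EReal) : Prop where
  convex : ConvexFun ψ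
  ne_bot : ∀ x, ψ x ≠ ⊥
  dom_nonempty : ∃ x, ψ x < ⊤
  lsc : LowerSemicontinuous ψ
  coercive : Tendsto ψ (Bornology.cobounded (EuclideanSpace ℝ (Fin n))) (𝓝 ⊤)

/-- The function `e^{-ψ}`, with `e^{-∞} = 0`. It is real-valued as `ψ` never takes the value
`-∞` where this is used. -/
def expNeg {n : ℕ} (ψ : EuclideanSpace ℝ (Fin n) → EReal) : EuclideanSpace ℝ (Fin n) → ℝ :=
  fun x => (EReal.exp (-ψ x)).toReal

/-- The class `LC_c(ℝⁿ)` of functions `e^{-ψ}` with `ψ ∈ Conv_c(ℝⁿ)`. -/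
def LCc (n : ℕ) : Set (EuclideanSpace ℝ (Fin n) → ℝ) :=
  {f | ∃ ψ, IsConvC ψ ∧ f = expNeg ψ}

/-- Total mass `J(f) = ∫ f`. -/
def totalMass {n : ℕ} (f : EuclideanSpace ℝ (Fin n) → ℝ) : ℝ := ∫ x, f x

/-- Infimal convolution `(φ □ ψ)(x) = inf_{y + z = x} (φ(y) + ψ(z))`. -/
def infConv {n : ℕ} (φ ψ : EuclideanSpace ℝ (Fin n) → EReal) :
    EuclideanSpace ℝ (Fin n) → EReal :=
  fun x => ⨅ y, φ y + ψ (x - y)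

/-- Epi-multiplication `x ↦ c ψ(x / c)`, for `c > 0`. -/
def epiMul {n : ℕ} (c : ℝ) (ψ : EuclideanSpace ℝ (Fin n) → EReal) :
    EuclideanSpace ℝ (Fin n) → EReal :=
  fun x => (c : EReal) * ψ (c⁻¹ • x)

/-- The reflection `R_u ψ = ψ ∘ R_u`, where `R_u` reflects in the hyperplane `u^⊥`. -/
def reflFun {n : ℕ} (u : EuclideanSpace ℝ (Fin n)) (ψ : EuclideanSpace ℝ (Fin n) → EReal) :
    EuclideanSpace ℝ (Fin n) → EReal :=
  fun x => ψ ((Submodule.span ℝ {u})ᗮ.reflection x)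

/-- The Minkowski symmetral of `ψ` in the direction `u`. -/
def minkSym {n : ℕ} (u : EuclideanSpace ℝ (Fin n)) (ψ : EuclideanSpace ℝ (Fin n) → EReal) :
    EuclideanSpace ℝ (Fin n) → EReal :=
  infConv (epiMul (1 / 2) ψ) (epiMul (1 / 2) (reflFun u ψ))

/-- Successive Minkowski symmetrals, in the directions `u 0`, `u 1`, …, `u (m - 1)` in this
order. -/
def iterMinkSym {n : ℕ} (u : ℕ → EuclideanSpace ℝ (Fin n))
    (ψ : EuclideanSpace ℝ (Fin n) → EReal) : ℕ → EuclideanSpace ℝ (Fin n) → EReal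
  | 0 => ψ
  | m + 1 => minkSym (u m) (iterMinkSym u ψ m)

/-- Epi-convergence of a sequence of functions. -/
def EpiConverges {n : ℕ} (Ψ : ℕ → EuclideanSpace ℝ (Fin n) → EReal)
    (φ : EuclideanSpace ℝ (Fin n) → EReal) : Prop :=
  ∀ x,
    (∀ y : ℕ → EuclideanSpace ℝ (Fin n), Tendsto y atTop (𝓝 x) →
      φ x ≤ liminf (fun j => Ψ j (y j)) atTop) ∧
    ∃ y : ℕ → EuclideanSpace ℝ (Fin n), Tendsto y atTop (𝓝 x) ∧
      Tendsto (fun j => Ψ j (y j)) atTop (𝓝 (φ x))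

/-- `φ` is an epi-symmetrization `ψ_sym` of `ψ`: a member of `Conv_c(ℝⁿ)`, invariant under
linear isometries, which is the epi-limit of successive Minkowski symmetrals of `ψ`. -/
structure IsEpiSymmetrization {n : ℕ} (ψ φ : EuclideanSpace ℝ (Fin n) → EReal) : Prop where
  isConvC : IsConvC φ
  invariant : ∀ (A : EuclideanSpace ℝ (Fin n) ≃ₗᵢ[ℝ] EuclideanSpace ℝ (Fin n)) (x),
    φ (A x) = φ x
  epiLimit : ∃ u : ℕ → EuclideanSpace ℝ (Fin n), (∀ i, ‖u i‖ = 1) ∧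
    EpiConverges (iterMinkSym u ψ) φ

/-- `g` is a hypo-symmetrization `f_sym = e^{-ψ_sym}` of `f = e^{-ψ}`. -/
def IsHypoSymmetrization {n : ℕ} (f g : EuclideanSpace ℝ (Fin n) → ℝ) : Prop :=
  ∃ ψ φ, IsConvC ψ ∧ f = expNeg ψ ∧ IsEpiSymmetrization ψ φ ∧ g = expNeg φ

end HypoSym

end

/-!
Minkowski symmetrization acts on epigraphs as the midpoint set of the epigraph and its reflection,
hence on Fenchel conjugates as averaging with the reflection. Finitely many reflections carry any
cap over the whole sphere, so iterated averaging contracts the oscillation of the conjugate on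
spheres, while points outside the largest centred ball in the domain of the conjugate are
eventually cut off. Enumerating these tasks gives one sequence of directions along which the
conjugates converge to a radial function; its conjugate is the epi-limit.

For the mass, slicing sublevel sets along lines parallel to `u` reduces `J f ≤ J (τ_u f)` to the
fact that the midpoint set of two intervals has the mean length, and a linear growth bound which is
uniform along the iteration lets the inequality pass to every epi-limit.
-/

noncomputable section

namespace HypoSym

open Metric

section Reflections

variable {E : Type*} [NormedAddCommGroup E] [InnerProductSpace ℝ E]

/-- The reflection `R_u` in the hyperplane `u^⊥`. -/
abbrev refl (u : E) : E ≃ₗᵢ[ℝ] E := (ℝ ∙ u)ᗮ.reflection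

lemma refl_refl (u x : E) : refl u (refl u x) = x :=
  Submodule.reflection_reflection _ x

lemma inner_refl_right (u x y : E) : inner ℝ x (refl u y) = inner ℝ (refl u x) y := by
  rw [← (refl u).inner_map_map x, refl_refl]

lemma exists_refl_eq_or_eq [Nontrivial E] {x p : E} (h : ‖x‖ = ‖p‖) :
    ∃ u : sphere (0 : E) 1, refl (u : E) x = p ∨ x = p := by
  rcases eq_or_ne x p with rfl | hne
  · obtain ⟨u, hu⟩ := exists_norm_eq E zero_le_one
    exact ⟨⟨u, mem_sphere_zero_iff_norm.2 hu⟩, .inr rfl⟩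
  have hpos : 0 < ‖x - p‖ := norm_sub_pos_iff.2 hne
  refine ⟨⟨(‖x - p‖⁻¹ : ℝ) • (x - p), ?_⟩, .inl ?_⟩
  · rw [mem_sphere_zero_iff_norm, norm_smul, norm_inv, norm_norm, inv_mul_cancel₀ hpos.ne']
  · simp only [refl, Submodule.span_singleton_smul_eq (IsUnit.mk0 _ (inv_ne_zero hpos.ne'))]
    exact Submodule.reflection_sub h

end Reflections

section Growth

variable {E : Type*} [NormedAddCommGroup E] {ψ : E → EReal} {a b : ℝ}

/-- The affine lower bound `a ‖x‖ + b ≤ ψ x`, the quantitative form of coercivity. -/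
def LinearGrowth (ψ : E → EReal) (a b : ℝ) : Prop :=
  ∀ x, ((a * ‖x‖ + b : ℝ) : EReal) ≤ ψ x

lemma LinearGrowth.le (h : LinearGrowth ψ a b) {x : E} {s : ℝ} (hx : ψ x ≤ s) :
    a * ‖x‖ + b ≤ s :=
  EReal.coe_le_coe_iff.1 ((h x).trans hx)

lemma linearGrowth_of_forall_le (h : ∀ x (s : ℝ), ψ x ≤ s → a * ‖x‖ + b ≤ s) :
    LinearGrowth ψ a b :=
  fun x => EReal.le_of_forall_lt_iff_le.1 fun s hs => EReal.coe_le_coe_iff.2 (h x s hs.le)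

lemma LinearGrowth.ne_bot (h : LinearGrowth ψ a b) (x : E) : ψ x ≠ ⊥ :=
  ((EReal.bot_lt_coe _).trans_le (h x)).ne'

lemma LinearGrowth.tendsto_cobounded (h : LinearGrowth ψ a b) (ha : 0 < a) :
    Tendsto ψ (Bornology.cobounded E) (𝓝 ⊤) := by
  refine tendsto_nhds_top_mono ?_ (Eventually.of_forall h)
  rw [EReal.tendsto_coe_nhds_top_iff]
  exact tendsto_atTop_add_const_right _ _ (tendsto_norm_cobounded_atTop.const_mul_atTop ha)

end Growth

section Convex

variable {n : ℕ} {ψ : EuclideanSpace ℝ (Fin n) → EReal}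

lemma ConvexFun.combo_le (h : ConvexFun ψ) {x y : EuclideanSpace ℝ (Fin n)} {s t a b : ℝ}
    (hx : ψ x ≤ s) (hy : ψ y ≤ t) (ha : 0 ≤ a) (hb : 0 ≤ b) (hab : a + b = 1) :
    ψ (a • x + b • y) ≤ ((a * s + b * t : ℝ) : EReal) :=
  h (x := (x, s)) hx (y := (y, t)) hy ha hb hab

lemma IsConvC.exists_le_coe (h : IsConvC ψ) : ∃ x, ∃ s : ℝ, ψ x ≤ s :=
  let ⟨x, hx⟩ := h.dom_nonempty
  let ⟨s, hs, _⟩ := EReal.lt_iff_exists_real_btwn.1 hx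
  ⟨x, s, hs.le⟩

lemma IsConvC.exists_coe_le_of_isCompact (h : IsConvC ψ) {K : Set (EuclideanSpace ℝ (Fin n))}
    (hK : IsCompact K) : ∃ m : ℝ, ∀ x ∈ K, (m : EReal) ≤ ψ x := by
  rcases K.eq_empty_or_nonempty with rfl | hne
  · exact ⟨0, by simp only [Set.mem_empty_iff_false, false_imp_iff, implies_true]⟩
  · obtain ⟨x₀, -, hmin⟩ := (h.lsc.lowerSemicontinuousOn K).exists_isMinOn hne hK
    obtain ⟨m, -, hm⟩ := EReal.lt_iff_exists_real_btwn.1 (bot_lt_iff_ne_bot.2 (h.ne_bot x₀))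
    exact ⟨m, fun x hx => hm.le.trans (hmin hx)⟩

lemma ConvexFun.add_norm_sub_div_le (h : ConvexFun ψ) {x₀ y : EuclideanSpace ℝ (Fin n)}
    {r s₀ s : ℝ} (hr : 0 < r) (h₀ : ψ x₀ ≤ s₀)
    (hsphere : ∀ x ∈ sphere x₀ r, ((s₀ + 1 : ℝ) : EReal) ≤ ψ x)
    (hy : r ≤ ‖y - x₀‖) (hs : ψ y ≤ s) : s₀ + ‖y - x₀‖ / r ≤ s := by
  have hd : 0 < ‖y - x₀‖ := hr.trans_le hy
  set l : ℝ := r / ‖y - x₀‖ with hl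
  have hl0 : 0 < l := by positivity
  have hl1 : l ≤ 1 := (div_le_one hd).2 hy
  have hmem : (1 - l) • x₀ + l • y ∈ sphere x₀ r := by
    rw [mem_sphere_iff_norm, show (1 - l) • x₀ + l • y - x₀ = l • (y - x₀) by module, norm_smul,
      Real.norm_of_nonneg hl0.le, hl, div_mul_cancel₀ _ hd.ne']
  have hmul : s₀ + 1 ≤ (1 - l) * s₀ + l * s := EReal.coe_le_coe_iff.1 <|
    (hsphere _ hmem).trans (h.combo_le h₀ hs (by linarith) hl0.le (by ring))
  have hdiv : 1 / l ≤ s - s₀ := (div_le_iff₀' hl0).2 (by linarith)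
  rw [hl, one_div_div] at hdiv
  linarith

theorem IsConvC.exists_linearGrowth (h : IsConvC ψ) : ∃ a > 0, ∃ b, LinearGrowth ψ a b := by
  obtain ⟨x₀, s₀, hs₀⟩ := h.exists_le_coe
  obtain ⟨R, hR⟩ := ((hasBasis_cobounded_compl_closedBall x₀).eventually_iff.1
    (h.coercive.eventually (lt_mem_nhds (EReal.coe_lt_top (s₀ + 1))))).imp fun _ h => h.2
  set r : ℝ := max R 0 + 1 with hr
  have hr0 : 0 < r := by positivity
  have hsphere : ∀ x ∈ sphere x₀ r, ((s₀ + 1 : ℝ) : EReal) ≤ ψ x := fun x hx => by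
    refine (hR ?_).le
    rw [Set.mem_compl_iff, mem_closedBall, mem_sphere.1 hx, hr]
    linarith [le_max_left R 0]
  obtain ⟨m, hm⟩ := h.exists_coe_le_of_isCompact (isCompact_closedBall x₀ r)
  refine ⟨1 / r, by positivity, min (m - 1) s₀ - ‖x₀‖ / r,
    linearGrowth_of_forall_le fun y s hs => ?_⟩
  have hnorm : 1 / r * ‖y‖ ≤ ‖y - x₀‖ / r + ‖x₀‖ / r := by
    rw [one_div_mul_eq_div, ← add_div]
    gcongr
    simpa only [sub_add_cancel] using norm_add_le (y - x₀) x₀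
  rcases le_or_gt ‖y - x₀‖ r with hy | hy
  · have hms : m ≤ s :=
      EReal.coe_le_coe_iff.1 ((hm y (mem_closedBall_iff_norm.2 hy)).trans hs)
    have : ‖y - x₀‖ / r ≤ 1 := (div_le_one hr0).2 hy
    linarith [min_le_left (m - 1) s₀]
  · have := h.convex.add_norm_sub_div_le hr0 hs₀ hsphere hy.le hs
    linarith [min_le_right (m - 1) s₀]

end Convex

section Epigraph

variable {E : Type*} {ψ : E → EReal}

/-- The real epigraph, as a subset of `E × ℝ`. All functions below are studied through it, so that
no arithmetic with infinite values is needed. -/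
def epigraph (ψ : E → EReal) : Set (E × ℝ) :=
  {p | ψ p.1 ≤ (p.2 : EReal)}

lemma isClosed_epigraph [TopologicalSpace E] (h : LowerSemicontinuous ψ) :
    IsClosed (epigraph ψ) :=
  h.isClosed_epigraph.preimage
    (continuous_fst.prodMk (continuous_coe_real_ereal.comp continuous_snd))

variable [NormedAddCommGroup E] {a b : ℝ}

lemma LinearGrowth.isCompact_epigraph_inter [ProperSpace E] (hg : LinearGrowth ψ a b) (ha : 0 < a)
    (h : LowerSemicontinuous ψ) (T : ℝ) : IsCompact (epigraph ψ ∩ {p | p.2 ≤ T}) := by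
  have hK := (isCompact_closedBall (0 : E) ((T - b) / a)).prod (isCompact_Icc (a := b) (b := T))
  refine hK.of_isClosed_subset
    ((isClosed_epigraph h).inter (isClosed_le continuous_snd continuous_const)) ?_
  rintro ⟨x, s⟩ ⟨hx : ψ x ≤ s, hs : s ≤ T⟩
  have hxs := hg.le hx
  have : 0 ≤ a * ‖x‖ := by positivity
  exact ⟨mem_closedBall_zero_iff.2 ((le_div_iff₀ ha).2 (by linarith)), by linarith, hs⟩

end Epigraph

section MinkSym

/-- The mean of a point of an epigraph and of the reflection of another one. -/
def reflMidpoint {E : Type*} [NormedAddCommGroup E] [InnerProductSpace ℝ E] (u : E)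
    (p q : E × ℝ) : E × ℝ :=
  ((1 / 2 : ℝ) • (p.1 + refl u q.1), (p.2 + q.2) / 2)

lemma continuous_reflMidpoint {E : Type*} [NormedAddCommGroup E] [InnerProductSpace ℝ E] (u : E) :
    Continuous (Function.uncurry (reflMidpoint u)) := by
  unfold reflMidpoint Function.uncurry
  fun_prop

lemma isLinearMap_reflMidpoint {E : Type*} [NormedAddCommGroup E] [InnerProductSpace ℝ E] (u : E) :
    IsLinearMap ℝ (Function.uncurry (reflMidpoint u)) where
  map_add p q := by
    refine Prod.ext ?_ ?_
    · simp only [reflMidpoint, Function.uncurry, Prod.fst_add, Prod.snd_add, map_add]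
      module
    · simp only [reflMidpoint, Function.uncurry, Prod.fst_add, Prod.snd_add]
      ring
  map_smul c p := by
    refine Prod.ext ?_ ?_
    · simp only [reflMidpoint, Function.uncurry, Prod.smul_fst, Prod.smul_snd, map_smul]
      module
    · simp only [reflMidpoint, Function.uncurry, Prod.smul_fst, Prod.smul_snd, smul_eq_mul]
      ring

lemma exists_add_div_two_eq {v w : EReal} (hv : v ≠ ⊥) (hw : w ≠ ⊥) {t : ℝ}
    (h : ((1 / 2 : ℝ) : EReal) * v + ((1 / 2 : ℝ) : EReal) * w ≤ t) :
    ∃ r s : ℝ, v ≤ r ∧ w ≤ s ∧ (r + s) / 2 = t := by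
  have half_mul_top : ((1 / 2 : ℝ) : EReal) * ⊤ = ⊤ := EReal.coe_mul_top_of_pos (by norm_num)
  induction v with
  | bot => exact absurd rfl hv
  | top =>
    induction w with
    | bot => exact absurd rfl hw
    | top => simp [half_mul_top, -one_div] at h
    | coe s => simp [half_mul_top, ← EReal.coe_mul, -one_div] at h
  | coe r =>
    induction w with
    | bot => exact absurd rfl hw
    | top => simp [half_mul_top, ← EReal.coe_mul, -one_div] at h
    | coe s =>
      refine ⟨r, 2 * t - r, le_rfl, ?_, by ring⟩
      norm_cast at h ⊢
      linarith

variable {n : ℕ} {ψ : EuclideanSpace ℝ (Fin n) → EReal} {a b : ℝ}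

lemma minkSym_apply (u : EuclideanSpace ℝ (Fin n)) (ψ : EuclideanSpace ℝ (Fin n) → EReal)
    (x : EuclideanSpace ℝ (Fin n)) : minkSym u ψ x =
      ⨅ y, ((1 / 2 : ℝ) : EReal) * ψ ((1 / 2 : ℝ)⁻¹ • y) +
        ((1 / 2 : ℝ) : EReal) * ψ (refl u ((1 / 2 : ℝ)⁻¹ • (x - y))) := rfl

lemma reflMidpoint_mem_epigraph_minkSym (u : EuclideanSpace ℝ (Fin n))
    {p q : EuclideanSpace ℝ (Fin n) × ℝ} (hp : p ∈ epigraph ψ) (hq : q ∈ epigraph ψ) :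
    reflMidpoint u p q ∈ epigraph (minkSym u ψ) := by
  have double_half (y : EuclideanSpace ℝ (Fin n)) : (1 / 2 : ℝ)⁻¹ • (1 / 2 : ℝ) • y = y :=
    inv_smul_smul₀ (by norm_num) y
  have : (0 : EReal) ≤ ((1 / 2 : ℝ) : EReal) := by norm_cast; norm_num
  calc minkSym u ψ ((1 / 2 : ℝ) • (p.1 + refl u q.1))
      ≤ ((1 / 2 : ℝ) : EReal) * ψ p.1 + ((1 / 2 : ℝ) : EReal) * ψ q.1 := by
        refine (minkSym_apply u ψ _).trans_le ((iInf_le _ ((1 / 2 : ℝ) • p.1)).trans_eq ?_)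
        rw [← smul_sub, add_sub_cancel_left, double_half, double_half, refl_refl]
    _ ≤ ((1 / 2 : ℝ) : EReal) * (p.2 : EReal) + ((1 / 2 : ℝ) : EReal) * (q.2 : EReal) := by
        gcongr
        exacts [hp, hq]
    _ = (((p.2 + q.2) / 2 : ℝ) : EReal) := by norm_cast; ring

lemma exists_reflMidpoint_eq_of_minkSym_lt (h : ∀ x, ψ x ≠ ⊥) {u x : EuclideanSpace ℝ (Fin n)}
    {t : ℝ} (ht : minkSym u ψ x < t) :
    ∃ p ∈ epigraph ψ, ∃ q ∈ epigraph ψ, reflMidpoint u p q = (x, t) := by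
  rw [minkSym_apply] at ht
  obtain ⟨y, hy⟩ := iInf_lt_iff.1 ht
  obtain ⟨r, s, hr, hs, hrs⟩ := exists_add_div_two_eq (h _) (h _) hy.le
  refine ⟨(_, r), hr, (_, s), hs, Prod.ext ?_ hrs⟩
  simp only [reflMidpoint]
  rw [refl_refl, ← smul_add, add_sub_cancel, smul_inv_smul₀ (by norm_num)]

lemma LinearGrowth.snd_le_of_reflMidpoint (hg : LinearGrowth ψ a b) (ha : 0 ≤ a)
    {u : EuclideanSpace ℝ (Fin n)} {p q : EuclideanSpace ℝ (Fin n) × ℝ} (hp : p ∈ epigraph ψ)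
    (hq : q ∈ epigraph ψ) {T : ℝ} (hT : (reflMidpoint u p q).2 ≤ T) :
    p.2 ≤ 2 * T - b ∧ q.2 ≤ 2 * T - b := by
  have hpb := hg.le hp
  have hqb := hg.le hq
  have : 0 ≤ a * ‖p.1‖ := by positivity
  have : 0 ≤ a * ‖q.1‖ := by positivity
  simp only [reflMidpoint] at hT
  constructor <;> linarith

lemma IsConvC.isCompact_image2_reflMidpoint (h : IsConvC ψ) (u : EuclideanSpace ℝ (Fin n))
    (T : ℝ) : IsCompact (Set.image2 (reflMidpoint u)
      (epigraph ψ ∩ {p | p.2 ≤ T}) (epigraph ψ ∩ {p | p.2 ≤ T})) := by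
  obtain ⟨a, ha, b, hg⟩ := h.exists_linearGrowth
  have hK := hg.isCompact_epigraph_inter ha h.lsc T
  rw [← Set.image_uncurry_prod]
  exact (hK.prod hK).image (continuous_reflMidpoint u)

theorem IsConvC.epigraph_minkSym (h : IsConvC ψ) (u : EuclideanSpace ℝ (Fin n)) :
    epigraph (minkSym u ψ) = Set.image2 (reflMidpoint u) (epigraph ψ) (epigraph ψ) := by
  refine Set.Subset.antisymm ?_
    (Set.image2_subset_iff.2 fun p hp q hq => reflMidpoint_mem_epigraph_minkSym u hp hq)
  rintro ⟨x, t⟩ (hx : minkSym u ψ x ≤ t)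
  obtain ⟨a, ha, b, hg⟩ := h.exists_linearGrowth
  set M : ℝ := 2 * (t + 1) - b
  -- The infimum is attained, as the means of points at bounded height form a closed set.
  set K := Set.image2 (reflMidpoint u) (epigraph ψ ∩ {p | p.2 ≤ M}) (epigraph ψ ∩ {p | p.2 ≤ M})
  have mem_K : ∀ t' ∈ Set.Ioo t (t + 1), (x, t') ∈ K := fun t' ht' => by
    obtain ⟨p, hp, q, hq, hpq⟩ := exists_reflMidpoint_eq_of_minkSym_lt h.ne_bot
      (hx.trans_lt (EReal.coe_lt_coe_iff.2 ht'.1))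
    obtain ⟨hpM, hqM⟩ := hg.snd_le_of_reflMidpoint ha.le (u := u) hp hq (T := t + 1)
      (by rw [hpq]; exact ht'.2.le)
    exact ⟨p, ⟨hp, hpM⟩, q, ⟨hq, hqM⟩, hpq⟩
  have hclosed : IsClosed {t' | (x, t') ∈ K} :=
    (h.isCompact_image2_reflMidpoint u M).isClosed.preimage (by fun_prop)
  have ht : t ∈ closure (Set.Ioo t (t + 1)) := by
    rw [closure_Ioo (by linarith)]
    exact ⟨le_rfl, by linarith⟩
  exact Set.image2_subset Set.inter_subset_left Set.inter_subset_left
    (closure_minimal mem_K hclosed ht)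

lemma IsConvC.linearGrowth_minkSym (h : IsConvC ψ) (u : EuclideanSpace ℝ (Fin n)) (ha : 0 ≤ a)
    (hg : LinearGrowth ψ a b) : LinearGrowth (minkSym u ψ) a b := by
  refine linearGrowth_of_forall_le fun x t hx => ?_
  have hmem : (x, t) ∈ epigraph (minkSym u ψ) := hx
  rw [h.epigraph_minkSym] at hmem
  obtain ⟨p, hp, q, hq, hpq⟩ := hmem
  obtain ⟨rfl, rfl⟩ := Prod.ext_iff.1 hpq
  have hnorm : ‖(1 / 2 : ℝ) • (p.1 + refl u q.1)‖ ≤ (‖p.1‖ + ‖q.1‖) / 2 := by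
    have := norm_add_le p.1 (refl u q.1)
    rw [LinearIsometryEquiv.norm_map] at this
    rw [norm_smul, Real.norm_of_nonneg (by norm_num)]
    linarith
  have := mul_le_mul_of_nonneg_left hnorm ha
  simp only [reflMidpoint]
  linarith [hg.le hp, hg.le hq]

lemma IsConvC.lowerSemicontinuous_minkSym (h : IsConvC ψ) (u : EuclideanSpace ℝ (Fin n)) :
    LowerSemicontinuous (minkSym u ψ) := by
  obtain ⟨a, ha, b, hg⟩ := h.exists_linearGrowth
  refine lowerSemicontinuous_iff_isClosed_preimage.2 fun c => ?_
  induction c with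
  | bot =>
    have hne := (h.linearGrowth_minkSym u ha.le hg).ne_bot
    simp only [Set.preimage, Set.mem_Iic, le_bot_iff, hne, Set.ofPred_false, isClosed_empty]
  | top => simp only [Set.Iic_top, Set.preimage_univ, isClosed_univ]
  | coe c =>
    suffices minkSym u ψ ⁻¹' Set.Iic (c : EReal) = {x | (x, c) ∈ Set.image2 (reflMidpoint u)
        (epigraph ψ ∩ {p | p.2 ≤ 2 * c - b}) (epigraph ψ ∩ {p | p.2 ≤ 2 * c - b})} by
      rw [this]
      exact (h.isCompact_image2_reflMidpoint u _).isClosed.preimage (by fun_prop)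
    ext x
    change (x, c) ∈ epigraph (minkSym u ψ) ↔ _
    rw [h.epigraph_minkSym]
    refine ⟨?_, fun hx => Set.image2_subset Set.inter_subset_left Set.inter_subset_left hx⟩
    rintro ⟨p, hp, q, hq, hpq⟩
    obtain ⟨hpc, hqc⟩ := hg.snd_le_of_reflMidpoint ha.le (u := u) hp hq (T := c) (by rw [hpq])
    exact ⟨p, ⟨hp, hpc⟩, q, ⟨hq, hqc⟩, hpq⟩

protected theorem IsConvC.minkSym (h : IsConvC ψ) (u : EuclideanSpace ℝ (Fin n)) :
    IsConvC (minkSym u ψ) := by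
  obtain ⟨a, ha, b, hg⟩ := h.exists_linearGrowth
  have hg' := h.linearGrowth_minkSym u ha.le hg
  refine ⟨?_, hg'.ne_bot, ?_, h.lowerSemicontinuous_minkSym u, hg'.tendsto_cobounded ha⟩
  · change Convex ℝ (epigraph (minkSym u ψ))
    rw [h.epigraph_minkSym, ← Set.image_uncurry_prod]
    exact (h.convex.prod h.convex).is_linear_image (isLinearMap_reflMidpoint u)
  · obtain ⟨x, s, hx⟩ := h.exists_le_coe
    have hmem : (x, s) ∈ epigraph ψ := hx
    exact ⟨_, (reflMidpoint_mem_epigraph_minkSym u hmem hmem).trans_lt (EReal.coe_lt_top _)⟩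

end MinkSym

section Volume

lemma volume_le_of_forall_sub_div_two_mem {K L : Set ℝ} (hK : IsCompact K) (hc : Convex ℝ K)
    (hL : ∀ s ∈ K, ∀ s' ∈ K, (s - s') / 2 ∈ L) : volume K ≤ volume L := by
  rcases K.eq_empty_or_nonempty with rfl | hne
  · simp only [measure_empty, zero_le]
  obtain ⟨a, b, rfl⟩ : ∃ a b, K = Set.Icc a b :=
    ⟨_, _, eq_Icc_of_connected_compact ⟨hne, hc.isPreconnected⟩ hK⟩
  have hsub : Set.Icc (-((b - a) / 2)) ((b - a) / 2) ⊆ L := by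
    rintro t ⟨ht, ht'⟩
    have := hL ((a + b) / 2 + t) ⟨by linarith, by linarith⟩ ((a + b) / 2 - t)
      ⟨by linarith, by linarith⟩
    rwa [show ((a + b) / 2 + t - ((a + b) / 2 - t)) / 2 = t by ring] at this
  calc volume (Set.Icc a b) = volume (Set.Icc (-((b - a) / 2)) ((b - a) / 2)) := by
        rw [Real.volume_Icc, Real.volume_Icc]
        congr 1
        ring
    _ ≤ volume L := measure_mono hsub

variable {E : Type*} [NormedAddCommGroup E] [InnerProductSpace ℝ E] [FiniteDimensional ℝ E]
  [MeasurableSpace E] [BorelSpace E]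

lemma measurePreserving_smul_add_orthogonal {u : E} (hu : ‖u‖ = 1) :
    MeasurePreserving fun p : ℝ × ((ℝ ∙ u)ᗮ : Submodule ℝ E) => p.1 • u + (p.2 : E) := by
  have hspan := (LinearIsometryEquiv.toSpanUnitSingleton u hu).measurePreserving
  have hprod := hspan.prod (MeasurePreserving.id (volume : Measure ((ℝ ∙ u)ᗮ : Submodule ℝ E)))
  have htoLp := WithLp.volume_preserving_toLp (ℝ ∙ u) ((ℝ ∙ u)ᗮ : Submodule ℝ E)
  exact ((ℝ ∙ u).orthogonalDecomposition.symm.measurePreserving.comp htoLp).comp hprod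

/-- Along each line orthogonal to the mirror, the mean of a convex body and its reflection contains
the Steiner symmetral of the body. -/
theorem volume_le_of_forall_midpoint_refl_mem {u : E} (hu : ‖u‖ = 1) {K L : Set E}
    (hK : IsCompact K) (hc : Convex ℝ K) (hLm : MeasurableSet L)
    (hL : ∀ y ∈ K, ∀ z ∈ K, (1 / 2 : ℝ) • (y + refl u z) ∈ L) : volume K ≤ volume L := by
  have hmp := measurePreserving_smul_add_orthogonal hu
  rw [← hmp.measure_preimage hK.measurableSet.nullMeasurableSet,
    ← hmp.measure_preimage hLm.nullMeasurableSet, Measure.volume_eq_prod,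
    Measure.prod_apply_symm (hmp.measurable hK.measurableSet),
    Measure.prod_apply_symm (hmp.measurable hLm)]
  refine lintegral_mono fun w => volume_le_of_forall_sub_div_two_mem ?_ ?_ ?_
  · have hisom : Isometry fun s : ℝ => s • u + (w : E) := Isometry.of_dist_eq fun s t => by
      rw [dist_add_right, dist_eq_norm, ← sub_smul, norm_smul, hu, mul_one, dist_eq_norm]
    exact hisom.isClosedEmbedding.isCompact_preimage hK
  · exact (hc.translate_preimage_left (w : E)).linear_preimage (LinearMap.toSpanSingleton ℝ E u)
  · intro s hs s' hs'
    have refl_u : refl u u = -u := Submodule.reflection_orthogonalComplement_singleton_eq_neg u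
    have refl_w : refl u (w : E) = w := Submodule.reflection_mem_subspace_eq_self w.2
    have hmem := hL _ hs _ hs'
    rw [map_add, map_smul, refl_u, refl_w] at hmem
    rw [Set.mem_preimage, Set.mem_preimage]
    convert hmem using 1
    module

end Volume

section Mass

lemma integrable_exp_neg_mul_norm_add {E : Type*} [NormedAddCommGroup E] [NormedSpace ℝ E]
    [FiniteDimensional ℝ E] [MeasurableSpace E] [BorelSpace E] (μ : Measure E) [μ.IsAddHaarMeasure]
    {a : ℝ} (ha : 0 < a) (b : ℝ) : Integrable (fun x => Real.exp (-(a * ‖x‖ + b))) μ := by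
  set k := Module.finrank ℝ E + 1
  have hint := (integrable_one_add_norm (E := E) (μ := μ) (r := k) (by simp [k])).const_mul
    (k.factorial / a ^ k * Real.exp (a - b))
  refine hint.mono' (by fun_prop) (Eventually.of_forall fun x => ?_)
  rw [Real.norm_of_nonneg (Real.exp_pos _).le, Real.rpow_neg (by positivity), Real.rpow_natCast]
  have hpow : (a * (1 + ‖x‖)) ^ k / k.factorial ≤ Real.exp (a * (1 + ‖x‖)) :=
    Real.pow_div_factorial_le_exp _ (by positivity) k
  have hsub : Real.exp (-(a * ‖x‖ + b)) = Real.exp (a - b) / Real.exp (a * (1 + ‖x‖)) := by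
    rw [← Real.exp_sub]
    ring_nf
  calc Real.exp (-(a * ‖x‖ + b))
      ≤ Real.exp (a - b) / ((a * (1 + ‖x‖)) ^ k / k.factorial) := by
        rw [hsub]
        gcongr
    _ = _ := by
        rw [mul_pow]
        field_simp

variable {n : ℕ} {ψ φ : EuclideanSpace ℝ (Fin n) → EReal} {a b : ℝ}

lemma LinearGrowth.exp_neg_le (h : LinearGrowth ψ a b) (x : EuclideanSpace ℝ (Fin n)) :
    EReal.exp (-ψ x) ≤ ENNReal.ofReal (Real.exp (-(a * ‖x‖ + b))) := by
  rw [← EReal.exp_coe, EReal.coe_neg]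
  exact EReal.exp_monotone (EReal.neg_le_neg_iff.2 (h x))

lemma IsConvC.measurable_exp_neg (h : IsConvC ψ) : Measurable fun x => EReal.exp (-ψ x) :=
  EReal.exp_monotone.measurable.comp h.lsc.measurable.neg

lemma IsConvC.exp_neg_ne_top (h : IsConvC ψ) (x : EuclideanSpace ℝ (Fin n)) :
    EReal.exp (-ψ x) ≠ ⊤ := by
  rw [Ne, EReal.exp_eq_top_iff, EReal.neg_eq_top_iff]
  exact h.ne_bot x

lemma IsConvC.lintegral_exp_neg_ne_top (h : IsConvC ψ) : ∫⁻ x, EReal.exp (-ψ x) ≠ ⊤ := by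
  obtain ⟨a, ha, b, hg⟩ := h.exists_linearGrowth
  exact ((lintegral_mono hg.exp_neg_le).trans_lt
    (integrable_exp_neg_mul_norm_add volume ha b).lintegral_lt_top).ne

theorem IsConvC.integrable_expNeg (h : IsConvC ψ) : Integrable (expNeg ψ) :=
  integrable_toReal_of_lintegral_ne_top h.measurable_exp_neg.aemeasurable
    h.lintegral_exp_neg_ne_top

lemma IsConvC.totalMass_expNeg (h : IsConvC ψ) :
    totalMass (expNeg ψ) = (∫⁻ x, EReal.exp (-ψ x)).toReal :=
  integral_toReal h.measurable_exp_neg.aemeasurable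
    (Eventually.of_forall fun x => lt_top_iff_ne_top.2 (h.exp_neg_ne_top x))

lemma IsConvC.le_expNeg_iff (h : IsConvC ψ) {x : EuclideanSpace ℝ (Fin n)} {t : ℝ} (ht : 0 < t) :
    t ≤ expNeg ψ x ↔ ψ x ≤ ((-Real.log t : ℝ) : EReal) := by
  unfold expNeg
  induction hψ : ψ x with
  | bot => exact absurd hψ (h.ne_bot x)
  | top =>
    simp only [EReal.neg_top, EReal.exp_bot, ENNReal.toReal_zero, not_le.2 ht, top_le_iff,
      EReal.coe_ne_top]
  | coe r =>
    rw [← EReal.coe_neg, EReal.exp_coe, ENNReal.toReal_ofReal (Real.exp_pos _).le,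
      EReal.coe_le_coe_iff, ← Real.log_le_iff_le_exp ht, le_neg]

lemma IsConvC.lintegral_exp_neg_eq_lintegral_sublevel (h : IsConvC ψ) :
    ∫⁻ x, EReal.exp (-ψ x) =
      ∫⁻ t in Set.Ioi (0 : ℝ), volume {x | ψ x ≤ ((-Real.log t : ℝ) : EReal)} := by
  calc ∫⁻ x, EReal.exp (-ψ x) = ∫⁻ x, ENNReal.ofReal (expNeg ψ x) :=
        lintegral_congr fun x => (ENNReal.ofReal_toReal (h.exp_neg_ne_top x)).symm
    _ = ∫⁻ t in Set.Ioi (0 : ℝ), volume {x | t ≤ expNeg ψ x} :=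
        lintegral_eq_lintegral_meas_le _ (Eventually.of_forall fun _ => ENNReal.toReal_nonneg)
          h.measurable_exp_neg.ennreal_toReal.aemeasurable
    _ = _ := setLIntegral_congr_fun measurableSet_Ioi fun t ht => by
        simp only [h.le_expNeg_iff ht]

lemma IsConvC.isCompact_sublevel (h : IsConvC ψ) (t : ℝ) : IsCompact {x | ψ x ≤ (t : EReal)} := by
  obtain ⟨a, ha, b, hg⟩ := h.exists_linearGrowth
  refine (isCompact_closedBall 0 ((t - b) / a)).of_isClosed_subset (h.lsc.isClosed_preimage _)
    fun x hx => ?_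
  rw [mem_closedBall_zero_iff, le_div_iff₀ ha]
  linarith [hg.le hx]

theorem IsConvC.lintegral_exp_neg_le_minkSym (h : IsConvC ψ) {u : EuclideanSpace ℝ (Fin n)}
    (hu : ‖u‖ = 1) : ∫⁻ x, EReal.exp (-ψ x) ≤ ∫⁻ x, EReal.exp (-minkSym u ψ x) := by
  rw [h.lintegral_exp_neg_eq_lintegral_sublevel,
    (h.minkSym u).lintegral_exp_neg_eq_lintegral_sublevel]
  refine lintegral_mono fun t => volume_le_of_forall_midpoint_refl_mem hu (h.isCompact_sublevel _)
    ?_ ((h.minkSym u).isCompact_sublevel _).measurableSet ?_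
  · intro x hx y hy c d hc hd hcd
    have := h.convex.combo_le hx hy hc hd hcd
    rwa [← add_mul, hcd, one_mul] at this
  · intro y hy z hz
    have hmid := reflMidpoint_mem_epigraph_minkSym u (p := (y, -Real.log t))
      (q := (z, -Real.log t)) hy hz
    rwa [epigraph, Set.mem_ofPred_eq, reflMidpoint, add_self_div_two] at hmid

protected lemma IsConvC.iterMinkSym (h : IsConvC ψ) (u : ℕ → EuclideanSpace ℝ (Fin n)) (m : ℕ) :
    IsConvC (iterMinkSym u ψ m) := by
  induction m with
  | zero => exact h
  | succ m ih => exact ih.minkSym _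

lemma IsConvC.linearGrowth_iterMinkSym (h : IsConvC ψ) (u : ℕ → EuclideanSpace ℝ (Fin n))
    (ha : 0 ≤ a) (hg : LinearGrowth ψ a b) (m : ℕ) : LinearGrowth (iterMinkSym u ψ m) a b := by
  induction m with
  | zero => exact hg
  | succ m ih => exact (h.iterMinkSym u m).linearGrowth_minkSym _ ha ih

lemma IsConvC.lintegral_exp_neg_le_iterMinkSym (h : IsConvC ψ)
    {u : ℕ → EuclideanSpace ℝ (Fin n)} (hu : ∀ i, ‖u i‖ = 1) (m : ℕ) :
    ∫⁻ x, EReal.exp (-ψ x) ≤ ∫⁻ x, EReal.exp (-iterMinkSym u ψ m x) := by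
  induction m with
  | zero => exact le_rfl
  | succ m ih => exact ih.trans ((h.iterMinkSym u m).lintegral_exp_neg_le_minkSym (hu m))

lemma EpiConverges.limsup_exp_neg_le {Ψ : ℕ → EuclideanSpace ℝ (Fin n) → EReal}
    (h : EpiConverges Ψ φ) (x : EuclideanSpace ℝ (Fin n)) :
    limsup (fun m => EReal.exp (-Ψ m x)) atTop ≤ EReal.exp (-φ x) := by
  have heq : EReal.exp (-liminf (fun m => Ψ m x) atTop) =
      limsup (fun m => EReal.exp (-Ψ m x)) atTop := by
    rw [← EReal.limsup_neg]
    exact EReal.exp_monotone.map_limsup_of_continuousAt _ ENNReal.continuous_exp.continuousAt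
  rw [← heq]
  exact EReal.exp_monotone (EReal.neg_le_neg_iff.2 ((h x).1 (fun _ => x) tendsto_const_nhds))

theorem IsEpiSymmetrization.totalMass_le (h : IsConvC ψ) (hs : IsEpiSymmetrization ψ φ) :
    totalMass (expNeg ψ) ≤ totalMass (expNeg φ) := by
  obtain ⟨u, hu, hlim⟩ := hs.epiLimit
  obtain ⟨a, ha, b, hg⟩ := h.exists_linearGrowth
  rw [h.totalMass_expNeg, hs.isConvC.totalMass_expNeg]
  refine ENNReal.toReal_mono hs.isConvC.lintegral_exp_neg_ne_top ?_
  calc ∫⁻ x, EReal.exp (-ψ x)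
      ≤ limsup (fun m => ∫⁻ x, EReal.exp (-iterMinkSym u ψ m x)) atTop :=
        le_limsup_of_frequently_le
          (Eventually.of_forall (h.lintegral_exp_neg_le_iterMinkSym hu)).frequently
    _ ≤ ∫⁻ x, limsup (fun m => EReal.exp (-iterMinkSym u ψ m x)) atTop :=
        limsup_lintegral_le _ (fun m => (h.iterMinkSym u m).measurable_exp_neg)
          (fun m => Eventually.of_forall (h.linearGrowth_iterMinkSym u ha.le hg m).exp_neg_le)
          (integrable_exp_neg_mul_norm_add volume ha b).lintegral_lt_top.ne
    _ ≤ ∫⁻ x, EReal.exp (-φ x) := lintegral_mono hlim.limsup_exp_neg_le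

end Mass

section Fenchel

variable {E : Type*} [NormedAddCommGroup E] [InnerProductSpace ℝ E] {ψ : E → EReal} {p : E}

/-- The values `⟨p, y⟩ - s` over the epigraph of `ψ`, whose supremum is the conjugate at `p`. -/
def fenchelValues (ψ : E → EReal) (p : E) : Set ℝ :=
  (fun q : E × ℝ => inner ℝ p q.1 - q.2) '' epigraph ψ

/-- The effective domain of the Fenchel conjugate of `ψ`. -/
def fenchelDom (ψ : E → EReal) : Set E :=
  {p | BddAbove (fenchelValues ψ p)}

/-- The Fenchel conjugate `ψ^*(p) = sup_y (⟨p, y⟩ - ψ y)`, as a real number; it is meaningful on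
`fenchelDom ψ` only, with junk value `0` elsewhere. -/
def fenchelConj (ψ : E → EReal) (p : E) : ℝ :=
  sSup (fenchelValues ψ p)

lemma fenchelValues_nonempty (hne : (epigraph ψ).Nonempty) (p : E) :
    (fenchelValues ψ p).Nonempty :=
  hne.image _

lemma inner_sub_le_fenchelConj (hp : p ∈ fenchelDom ψ) {y : E} {s : ℝ} (hy : ψ y ≤ s) :
    inner ℝ p y - s ≤ fenchelConj ψ p :=
  le_csSup hp ⟨(y, s), hy, rfl⟩

lemma mem_fenchelDom_of_forall_le {c : ℝ}
    (h : ∀ y (s : ℝ), ψ y ≤ s → inner ℝ p y - s ≤ c) : p ∈ fenchelDom ψ :=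
  ⟨c, Set.forall_mem_image.2 fun q hq => h q.1 q.2 hq⟩

lemma fenchelConj_le (hne : (epigraph ψ).Nonempty) {c : ℝ}
    (h : ∀ y (s : ℝ), ψ y ≤ s → inner ℝ p y - s ≤ c) : fenchelConj ψ p ≤ c :=
  csSup_le (fenchelValues_nonempty hne p) (Set.forall_mem_image.2 fun q hq => h q.1 q.2 hq)

lemma convexOn_fenchelConj (hne : (epigraph ψ).Nonempty) :
    ConvexOn ℝ (fenchelDom ψ) (fenchelConj ψ) := by
  have inner_combo_sub_le : ∀ p ∈ fenchelDom ψ, ∀ q ∈ fenchelDom ψ, ∀ a b : ℝ, 0 ≤ a → 0 ≤ b →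
      a + b = 1 → ∀ y (s : ℝ), ψ y ≤ s →
        inner ℝ (a • p + b • q) y - s ≤ a • fenchelConj ψ p + b • fenchelConj ψ q := by
    intro p hp q hq a b ha hb hab y s hy
    have hs : s = a * s + b * s := by rw [← add_mul, hab, one_mul]
    calc inner ℝ (a • p + b • q) y - s
        = a * (inner ℝ p y - s) + b * (inner ℝ q y - s) := by
          rw [inner_add_left, real_inner_smul_left, real_inner_smul_left]
          linarith
      _ ≤ a * fenchelConj ψ p + b * fenchelConj ψ q := by
          gcongr
          exacts [inner_sub_le_fenchelConj hp hy, inner_sub_le_fenchelConj hq hy]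
  exact ⟨fun p hp q hq a b ha hb hab =>
      mem_fenchelDom_of_forall_le (inner_combo_sub_le p hp q hq a b ha hb hab),
    fun p hp q hq a b ha hb hab =>
      fenchelConj_le hne (inner_combo_sub_le p hp q hq a b ha hb hab)⟩

lemma LinearGrowth.closedBall_subset_fenchelDom {a b : ℝ} (h : LinearGrowth ψ a b) :
    closedBall 0 a ⊆ fenchelDom ψ := fun p hp => by
  refine mem_fenchelDom_of_forall_le (c := -b) fun y s hy => ?_
  have hpy : inner ℝ p y ≤ a * ‖y‖ := (real_inner_le_norm p y).trans <|
    mul_le_mul_of_nonneg_right (mem_closedBall_zero_iff.1 hp) (norm_nonneg y)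
  linarith [h.le hy]

end Fenchel

section FenchelMinkSym

open scoped Pointwise

variable {n : ℕ} {ψ : EuclideanSpace ℝ (Fin n) → EReal}

lemma IsConvC.epigraph_nonempty (h : IsConvC ψ) : (epigraph ψ).Nonempty :=
  let ⟨x, s, hs⟩ := h.exists_le_coe
  ⟨(x, s), hs⟩

lemma IsConvC.fenchelValues_minkSym (h : IsConvC ψ) (u p : EuclideanSpace ℝ (Fin n)) :
    fenchelValues (minkSym u ψ) p =
      (1 / 2 : ℝ) • (fenchelValues ψ p + fenchelValues ψ (refl u p)) := by
  rw [fenchelValues, h.epigraph_minkSym, ← Set.image2_add, fenchelValues, fenchelValues,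
    Set.image2_image_left, Set.image2_image_right, Set.image_image2, ← Set.image_smul,
    Set.image_image2]
  refine Set.image2_congr' fun q q' => ?_
  rw [reflMidpoint, real_inner_smul_right, inner_add_right, inner_refl_right, smul_eq_mul]
  ring

theorem IsConvC.fenchelDom_minkSym (h : IsConvC ψ) (u : EuclideanSpace ℝ (Fin n)) :
    fenchelDom (minkSym u ψ) = fenchelDom ψ ∩ refl u ⁻¹' fenchelDom ψ := by
  ext p
  change BddAbove (fenchelValues (minkSym u ψ) p) ↔ _
  rw [h.fenchelValues_minkSym, bddAbove_smul_iff_of_pos (by norm_num)]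
  refine ⟨fun ⟨c, hc⟩ => ?_, fun ⟨hp, hrp⟩ => hp.add hrp⟩
  obtain ⟨v, hv⟩ : (fenchelValues ψ p).Nonempty := fenchelValues_nonempty h.epigraph_nonempty _
  obtain ⟨w, hw⟩ : (fenchelValues ψ (refl u p)).Nonempty :=
    fenchelValues_nonempty h.epigraph_nonempty _
  exact ⟨⟨c - w, fun v' hv' => le_sub_iff_add_le.2 (hc (Set.add_mem_add hv' hw))⟩,
    ⟨c - v, fun w' hw' => le_sub_iff_add_le'.2 (hc (Set.add_mem_add hv hw'))⟩⟩

theorem IsConvC.fenchelConj_minkSym (h : IsConvC ψ) {u p : EuclideanSpace ℝ (Fin n)}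
    (hp : p ∈ fenchelDom ψ) (hrp : refl u p ∈ fenchelDom ψ) :
    fenchelConj (minkSym u ψ) p = (fenchelConj ψ p + fenchelConj ψ (refl u p)) / 2 := by
  rw [fenchelConj, h.fenchelValues_minkSym, Real.sSup_smul_of_nonneg (by norm_num),
    csSup_add (fenchelValues_nonempty h.epigraph_nonempty p) hp
      (fenchelValues_nonempty h.epigraph_nonempty _) hrp, smul_eq_mul, one_div_mul_eq_div]
  rfl

end FenchelMinkSym

section ReflInvariant

variable {E : Type*} [NormedAddCommGroup E] [InnerProductSpace ℝ E]

/-- Invariance under all hyperplane reflections; balls and spheres about the origin have it. -/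
def IsReflInvariant (S : Set E) : Prop :=
  ∀ u, ∀ x ∈ S, refl u x ∈ S

lemma isReflInvariant_sphere (r : ℝ) : IsReflInvariant (sphere (0 : E) r) := fun u x hx => by
  rwa [mem_sphere_zero_iff_norm, LinearIsometryEquiv.norm_map, ← mem_sphere_zero_iff_norm]

lemma isReflInvariant_closedBall (r : ℝ) : IsReflInvariant (closedBall (0 : E) r) :=
  fun u x hx => by
    rwa [mem_closedBall_zero_iff, LinearIsometryEquiv.norm_map, ← mem_closedBall_zero_iff]

end ReflInvariant

section Means

lemma exists_sub_le_of_dist_lt {X : Type*} [PseudoMetricSpace X] {K : Set X} {f : X → ℝ}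
    (hK : IsCompact K) (hf : ContinuousOn f K) {ε : ℝ} (hε : 0 < ε) :
    ∃ δ > 0, ∀ x ∈ K, ∀ y ∈ K, dist x y < δ → f x - f y ≤ ε := by
  obtain ⟨δ, hδ, hmod⟩ :=
    Metric.uniformContinuousOn_iff.1 (hK.uniformContinuousOn_of_continuous hf) ε hε
  exact ⟨δ, hδ, fun x hx y hy hxy => (le_abs_self _).trans (hmod x hx y hy hxy).le⟩

variable {E : Type*} [NormedAddCommGroup E] [InnerProductSpace ℝ E] {f g : E → ℝ} {S : Set E}
  {ρ δ ε m M c : ℝ}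

/-- The mean of a function and its reflection: the effect of a Minkowski symmetrization on
conjugates. -/
def reflMean (u : E) (f : E → ℝ) : E → ℝ :=
  fun p => (f p + f (refl u p)) / 2

/-- Successive means of a function with its reflections. -/
def meanAlong (us : List (sphere (0 : E) 1)) (f : E → ℝ) : E → ℝ :=
  us.foldl (fun g (u : sphere (0 : E) 1) => reflMean (u : E) g) f

/-- The set of points carried into `V` by the product of a subfamily of the reflections. -/
def spread (us : List (sphere (0 : E) 1)) (V : Set E) : Set E :=
  us.foldl (fun W (u : sphere (0 : E) 1) => W ∪ refl (u : E) ⁻¹' W) V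

/-- The oscillation of `f` on the sphere of radius `ρ` about `0` is at most `ε`. -/
def SphereOscLE (f : E → ℝ) (ρ ε : ℝ) : Prop :=
  ∀ x ∈ sphere (0 : E) ρ, ∀ y ∈ sphere (0 : E) ρ, f x - f y ≤ ε

protected lemma SphereOscLE.reflMean (h : SphereOscLE f ρ ε) (u : E) :
    SphereOscLE (reflMean u f) ρ ε := fun x hx y hy => by
  have hrefl := h _ (isReflInvariant_sphere ρ u x hx) _ (isReflInvariant_sphere ρ u y hy)
  simp only [HypoSym.reflMean]
  linarith [h x hx y hy]

lemma subset_spread (us : List (sphere (0 : E) 1)) (V : Set E) : V ⊆ spread us V := by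
  induction us generalizing V with
  | nil => exact subset_rfl
  | cons u _ ih => exact Set.subset_union_left.trans (ih _)

lemma spread_mono (us : List (sphere (0 : E) 1)) {V W : Set E} (h : V ⊆ W) :
    spread us V ⊆ spread us W := by
  induction us generalizing V W with
  | nil => exact h
  | cons u _ ih => exact ih (Set.union_subset_union h (Set.preimage_mono h))

lemma preimage_refl_subset_spread {us : List (sphere (0 : E) 1)} {u : sphere (0 : E) 1}
    (hu : u ∈ us) (V : Set E) : refl (u : E) ⁻¹' V ⊆ spread us V := by
  induction us generalizing V with
  | nil => exact absurd hu List.not_mem_nil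
  | cons w us ih =>
    rcases List.mem_cons.1 hu with rfl | hu
    · exact Set.subset_union_right.trans (subset_spread us _)
    · exact (Set.preimage_mono Set.subset_union_left).trans (ih hu (V ∪ refl (w : E) ⁻¹' V))

/-- The number of reflections needed to carry a cap over the whole sphere depends only on the
radius of the cap. -/
theorem exists_sphere_subset_spread_ball [FiniteDimensional ℝ E] [Nontrivial E] (ρ : ℝ)
    (hδ : 0 < δ) : ∃ N : ℕ, ∀ p ∈ sphere (0 : E) ρ, ∃ us : List (sphere (0 : E) 1),
      us.length = N ∧ sphere 0 ρ ⊆ spread us (ball p δ) := by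
  obtain ⟨t, hts, htfin, hcover⟩ := (isCompact_sphere (0 : E) ρ).finite_cover_balls hδ
  refine ⟨htfin.toFinset.toList.length, fun p hp => ?_⟩
  have hdir : ∀ z : E, ∃ u : sphere (0 : E) 1, z ∈ t → refl (u : E) z = p ∨ z = p := by
    intro z
    by_cases hz : z ∈ t
    · have hnorm : ‖z‖ = ‖p‖ := by
        rw [mem_sphere_zero_iff_norm.1 (hts hz), mem_sphere_zero_iff_norm.1 hp]
      obtain ⟨u, hu⟩ := exists_refl_eq_or_eq hnorm
      exact ⟨u, fun _ => hu⟩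
    · obtain ⟨u, -⟩ := exists_refl_eq_or_eq (rfl : ‖p‖ = ‖p‖)
      exact ⟨u, fun h => absurd h hz⟩
  choose d hd using hdir
  refine ⟨htfin.toFinset.toList.map d, List.length_map _, hcover.trans (Set.iUnion₂_subset ?_)⟩
  intro z hz
  rcases hd z hz with hzp | rfl
  · have hmem : d z ∈ htfin.toFinset.toList.map d :=
      List.mem_map_of_mem (Finset.mem_toList.2 (htfin.mem_toFinset.2 hz))
    rw [← hzp, ← LinearIsometryEquiv.coe_toHomeomorph]
    refine subset_trans ?_ (preimage_refl_subset_spread hmem _)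
    intro y hy
    rwa [Set.mem_preimage, LinearIsometryEquiv.coe_toHomeomorph, mem_ball,
      LinearIsometryEquiv.dist_map]
  · exact subset_spread _ _

lemma le_meanAlong (hS : IsReflInvariant S) (us : List (sphere (0 : E) 1))
    (hm : ∀ x ∈ S, m ≤ f x) : ∀ x ∈ S, m ≤ meanAlong us f x := by
  induction us generalizing f with
  | nil => exact hm
  | cons u _ ih =>
    refine ih fun x hx => ?_
    simp only [reflMean]
    linarith [hm x hx, hm _ (hS u x hx)]

/-- Each mean at least halves the gain. -/
lemma meanAlong_le_sub_of_mem_spread (hS : IsReflInvariant S) (us : List (sphere (0 : E) 1))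
    {V : Set E} (hM : ∀ x ∈ S, f x ≤ M) (hc : 0 ≤ c) (hV : ∀ x ∈ S ∩ V, f x ≤ M - c) :
    ∀ x ∈ S ∩ spread us V, meanAlong us f x ≤ M - c / 2 ^ us.length := by
  induction us generalizing f V c with
  | nil => simpa only [List.length_nil, pow_zero, div_one] using! hV
  | cons u _ ih =>
    rw [List.length_cons, pow_succ', ← div_div]
    refine ih (fun x hx => ?_) (by positivity) ?_
    · simp only [reflMean]
      linarith [hM x hx, hM _ (hS u x hx)]
    · rintro x ⟨hx, hxV | hxV⟩ <;> simp only [reflMean]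
      · linarith [hV x ⟨hx, hxV⟩, hM _ (hS u x hx)]
      · linarith [hM x hx, hV _ ⟨hS u x hx, hxV⟩]

lemma meanAlong_sub_le_of_dist_lt (hS : IsReflInvariant S) (us : List (sphere (0 : E) 1))
    (hf : ∀ x ∈ S, ∀ y ∈ S, dist x y < δ → f x - f y ≤ ε) :
    ∀ x ∈ S, ∀ y ∈ S, dist x y < δ → meanAlong us f x - meanAlong us f y ≤ ε := by
  induction us generalizing f with
  | nil => exact hf
  | cons u _ ih =>
    refine ih fun x hx y hy hxy => ?_
    have hrefl := hf _ (hS u x hx) _ (hS u y hy) ((LinearIsometryEquiv.dist_map _ x y).trans_lt hxy)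
    simp only [reflMean]
    linarith [hf x hx y hy hxy]

theorem exists_sphereOscLE_meanAlong [FiniteDimensional ℝ E] [Nontrivial E]
    (hf : ContinuousOn f (sphere 0 ρ)) (hε : 0 < ε) :
    ∃ us : List (sphere (0 : E) 1), SphereOscLE (meanAlong us f) ρ ε := by
  rcases (sphere (0 : E) ρ).eq_empty_or_nonempty with hempty | ⟨x₀, hx₀⟩
  · exact ⟨[], fun x hx => absurd hx (hempty ▸ Set.notMem_empty x)⟩
  have hcompact := (isCompact_sphere (0 : E) ρ).image_of_continuousOn hf
  obtain ⟨m, hm⟩ := hcompact.bddBelow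
  obtain ⟨M₀, hM₀⟩ := hcompact.bddAbove
  obtain ⟨δ, hδ, hmod⟩ := exists_sub_le_of_dist_lt (isCompact_sphere (0 : E) ρ) hf (half_pos hε)
  obtain ⟨N, hN⟩ := exists_sphere_subset_spread_ball (E := E) ρ hδ
  set η : ℝ := ε / 2 / 2 ^ N with hη
  -- If the maximum is within `η` of the least one attainable, no cap lies `ε / 2` below it.
  set bounds : Set ℝ :=
    {M | ∃ us : List (sphere (0 : E) 1), ∀ x ∈ sphere 0 ρ, meanAlong us f x ≤ M}
  have hbdd : BddBelow bounds := ⟨m, fun M ⟨us, hus⟩ =>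
    (le_meanAlong (isReflInvariant_sphere ρ) us
      (fun x hx => hm (Set.mem_image_of_mem f hx)) x₀ hx₀).trans (hus x₀ hx₀)⟩
  have hne : bounds.Nonempty := ⟨M₀, [], fun x hx => hM₀ (Set.mem_image_of_mem f hx)⟩
  obtain ⟨M, ⟨us, hus⟩, hlt⟩ := Real.lt_sInf_add_pos hne (show 0 < η by positivity)
  refine ⟨us, fun p hp q hq => le_of_not_gt fun hosc => ?_⟩
  obtain ⟨vs, hlen, hcover⟩ := hN q hq
  have hcap : ∀ x ∈ sphere 0 ρ ∩ ball q δ, meanAlong us f x ≤ M - ε / 2 := fun x hx => by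
    have := meanAlong_sub_le_of_dist_lt (isReflInvariant_sphere ρ) us hmod x hx.1 q hq hx.2
    linarith [hus p hp]
  have hmem : M - η ∈ bounds := by
    refine ⟨us ++ vs, fun x hx => ?_⟩
    rw [meanAlong, List.foldl_append, hη, ← hlen]
    exact meanAlong_le_sub_of_mem_spread (isReflInvariant_sphere ρ) vs hus (half_pos hε).le hcap x
      ⟨hx, hcover hx⟩
  linarith [csInf_le hbdd hmem]

lemma meanAlong_append (us vs : List (sphere (0 : E) 1)) (f : E → ℝ) :
    meanAlong (us ++ vs) f = meanAlong vs (meanAlong us f) :=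
  List.foldl_append

protected lemma SphereOscLE.meanAlong (h : SphereOscLE f ρ ε) (us : List (sphere (0 : E) 1)) :
    SphereOscLE (meanAlong us f) ρ ε := by
  induction us generalizing f with
  | nil => exact h
  | cons u _ ih => exact ih (h.reflMean u)

lemma continuousOn_meanAlong (hS : IsReflInvariant S) (us : List (sphere (0 : E) 1))
    (hf : ContinuousOn f S) : ContinuousOn (meanAlong us f) S := by
  induction us generalizing f with
  | nil => exact hf
  | cons u _ ih =>
    exact ih ((hf.add (hf.comp (LinearIsometryEquiv.continuous _).continuousOn (hS u))).div_const 2)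

lemma SphereOscLE.of_dist_lt {r s : ℝ} (h : SphereOscLE f ρ (ε / 3)) (hε : 0 ≤ ε)
    (hf : ∀ x ∈ closedBall 0 r, ∀ y ∈ closedBall 0 r, dist x y < δ → f x - f y ≤ ε / 3)
    (hρ : ρ ∈ Set.Icc 0 r) (hs : s ∈ Set.Icc 0 r) (hρs : dist s ρ < δ) : SphereOscLE f s ε := by
  intro x hx y hy
  rw [mem_sphere_zero_iff_norm] at hx hy
  rcases hs.1.eq_or_lt with rfl | hpos
  · rw [norm_eq_zero.1 hx, norm_eq_zero.1 hy, sub_self]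
    exact hε
  have exists_near : ∀ z : E, ‖z‖ = s → ∃ w ∈ sphere (0 : E) ρ, dist z w < δ := fun z hz => by
    refine ⟨(ρ / s) • z, ?_, ?_⟩
    · rw [mem_sphere_zero_iff_norm, norm_smul, Real.norm_of_nonneg (div_nonneg hρ.1 hpos.le), hz,
        div_mul_cancel₀ _ hpos.ne']
    · have hsub : z - (ρ / s) • z = ((s - ρ) / s) • z := by
        rw [sub_div, div_self hpos.ne', sub_smul, one_smul]
      rwa [dist_eq_norm, hsub, norm_smul, norm_div, Real.norm_of_nonneg hpos.le, hz,
        div_mul_cancel₀ _ hpos.ne']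
  obtain ⟨x', hx', hxx'⟩ := exists_near x hx
  obtain ⟨y', hy', hyy'⟩ := exists_near y hy
  have mem_ball_of_norm : ∀ z : E, ‖z‖ = s → z ∈ closedBall (0 : E) r := fun z hz =>
    mem_closedBall_zero_iff.2 (hz.trans_le hs.2)
  have hsub : sphere (0 : E) ρ ⊆ closedBall 0 r :=
    sphere_subset_closedBall.trans (closedBall_subset_closedBall hρ.2)
  linarith [hf x (mem_ball_of_norm x hx) x' (hsub hx') hxx', h x' hx' y' hy',
    hf y' (hsub hy') y (mem_ball_of_norm y hy) (dist_comm y y' ▸ hyy')]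

theorem exists_forall_sphereOscLE_meanAlong [FiniteDimensional ℝ E] [Nontrivial E] {r : ℝ}
    (hf : ContinuousOn f (closedBall 0 r)) (hε : 0 < ε) :
    ∃ us : List (sphere (0 : E) 1), ∀ s ∈ Set.Icc 0 r, SphereOscLE (meanAlong us f) s ε := by
  obtain ⟨δ, hδ, hmod⟩ :=
    exists_sub_le_of_dist_lt (isCompact_closedBall (0 : E) r) hf (div_pos hε three_pos)
  suffices ∀ vs : List (sphere (0 : E) 1), ∃ us : List (sphere (0 : E) 1), ∀ s ∈ Set.Icc 0 r,
      SphereOscLE (meanAlong (vs ++ us) f) s ε from this []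
  refine isCompact_Icc.induction_on (p := fun T : Set ℝ => ∀ vs : List (sphere (0 : E) 1),
    ∃ us : List (sphere (0 : E) 1), ∀ s ∈ T, SphereOscLE (meanAlong (vs ++ us) f) s ε)
    (fun _ => ⟨[], fun _ hs => absurd hs (Set.notMem_empty _)⟩) ?_ ?_ ?_
  · intro T T' hTT' hT' vs
    obtain ⟨us, hus⟩ := hT' vs
    exact ⟨us, fun s hs => hus s (hTT' hs)⟩
  · intro T T' hT hT' vs
    obtain ⟨us, hus⟩ := hT vs
    obtain ⟨us', hus'⟩ := hT' (vs ++ us)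
    refine ⟨us ++ us', ?_⟩
    rw [← List.append_assoc]
    rintro s (hs | hs)
    · rw [meanAlong_append]
      exact (hus s hs).meanAlong us'
    · exact hus' s hs
  · intro ρ hρ
    refine ⟨Set.Icc 0 r ∩ ball ρ δ, inter_mem_nhdsWithin _ (ball_mem_nhds ρ hδ), fun vs => ?_⟩
    have hsphere : sphere (0 : E) ρ ⊆ closedBall 0 r :=
      sphere_subset_closedBall.trans (closedBall_subset_closedBall hρ.2)
    obtain ⟨us, hus⟩ := exists_sphereOscLE_meanAlong
      (continuousOn_meanAlong (isReflInvariant_sphere ρ) vs (hf.mono hsphere))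
      (div_pos hε three_pos)
    rw [← meanAlong_append] at hus
    exact ⟨us, fun s hs => hus.of_dist_lt hε.le
      (meanAlong_sub_le_of_dist_lt (isReflInvariant_closedBall r) _ hmod) hρ hs.1 hs.2⟩

end Means

section ListMinkSym

variable {n : ℕ} {ψ : EuclideanSpace ℝ (Fin n) → EReal} {S : Set (EuclideanSpace ℝ (Fin n))}
  {f : EuclideanSpace ℝ (Fin n) → ℝ} {σ : ℝ}

/-- Successive Minkowski symmetrals in the directions of a list. -/
def listMinkSym (us : List (sphere (0 : EuclideanSpace ℝ (Fin n)) 1))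
    (ψ : EuclideanSpace ℝ (Fin n) → EReal) : EuclideanSpace ℝ (Fin n) → EReal :=
  us.foldl (fun φ (u : sphere (0 : EuclideanSpace ℝ (Fin n)) 1) => minkSym u φ) ψ

protected lemma IsConvC.listMinkSym (h : IsConvC ψ)
    (us : List (sphere (0 : EuclideanSpace ℝ (Fin n)) 1)) : IsConvC (listMinkSym us ψ) := by
  induction us generalizing ψ with
  | nil => exact h
  | cons u _ ih => exact ih (h.minkSym u)

lemma IsConvC.compl_fenchelDom_listMinkSym (h : IsConvC ψ)
    (us : List (sphere (0 : EuclideanSpace ℝ (Fin n)) 1)) :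
    (fenchelDom (listMinkSym us ψ))ᶜ = spread us (fenchelDom ψ)ᶜ := by
  induction us generalizing ψ with
  | nil => rfl
  | cons u _ ih =>
    refine (ih (h.minkSym u)).trans ?_
    rw [h.fenchelDom_minkSym, Set.compl_inter]
    rfl

lemma IsConvC.subset_interior_fenchelDom_minkSym (h : IsConvC ψ) (hS : IsReflInvariant S)
    (hSD : S ⊆ interior (fenchelDom ψ)) (u : EuclideanSpace ℝ (Fin n)) :
    S ⊆ interior (fenchelDom (minkSym u ψ)) := by
  rw [h.fenchelDom_minkSym, interior_inter, ← LinearIsometryEquiv.coe_toHomeomorph,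
    ← Homeomorph.preimage_interior]
  exact Set.subset_inter hSD fun p hp => hSD (hS u p hp)

lemma IsConvC.eqOn_fenchelConj_listMinkSym (h : IsConvC ψ) (hS : IsReflInvariant S)
    (hSD : S ⊆ interior (fenchelDom ψ)) (hf : Set.EqOn (fenchelConj ψ) f S)
    (us : List (sphere (0 : EuclideanSpace ℝ (Fin n)) 1)) :
    Set.EqOn (fenchelConj (listMinkSym us ψ)) (meanAlong us f) S := by
  induction us generalizing ψ f with
  | nil => exact hf
  | cons u _ ih =>
    refine ih (h.minkSym u) (h.subset_interior_fenchelDom_minkSym hS hSD u) fun p hp => ?_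
    have hrp := hS u p hp
    rw [h.fenchelConj_minkSym (interior_subset (hSD hp)) (interior_subset (hSD hrp)), hf hp,
      hf hrp]
    rfl

lemma IsConvC.convexOn_fenchelConj (h : IsConvC ψ) :
    ConvexOn ℝ (fenchelDom ψ) (fenchelConj ψ) :=
  HypoSym.convexOn_fenchelConj h.epigraph_nonempty

lemma IsConvC.zero_mem_interior_fenchelDom (h : IsConvC ψ) : 0 ∈ interior (fenchelDom ψ) := by
  obtain ⟨a, ha, b, hg⟩ := h.exists_linearGrowth
  exact mem_interior.2 ⟨ball 0 a, ball_subset_closedBall.trans hg.closedBall_subset_fenchelDom,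
    isOpen_ball, mem_ball_self ha⟩

/-- A point missing from the domain keeps a cap of every larger sphere out of it, and reflections
spread the cap. -/
theorem IsConvC.exists_fenchelDom_listMinkSym_subset_ball [NeZero n] (h : IsConvC ψ)
    (hσ : ¬ ball 0 σ ⊆ fenchelDom ψ) : ∃ us, fenchelDom (listMinkSym us ψ) ⊆ ball 0 σ := by
  obtain ⟨p₀, hp₀σ, hp₀⟩ := Set.not_subset.1 hσ
  rw [mem_ball_zero_iff] at hp₀σ
  have hp₀pos : 0 < ‖p₀‖ := norm_pos_iff.2 fun h0 =>
    hp₀ (h0 ▸ interior_subset h.zero_mem_interior_fenchelDom)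
  have hσpos : 0 < σ := hp₀pos.trans hp₀σ
  set q₀ := (σ / ‖p₀‖) • p₀ with hq₀
  have hq₀σ : q₀ ∈ sphere 0 σ := by
    rw [mem_sphere_zero_iff_norm, hq₀, norm_smul, Real.norm_of_nonneg (by positivity),
      div_mul_cancel₀ _ hp₀pos.ne']
  have hq₀closure : q₀ ∉ closure (fenchelDom ψ) := fun hq => by
    have hseg := h.convexOn_fenchelConj.1.openSegment_interior_closure_subset_interior
      h.zero_mem_interior_fenchelDom hq
    refine hp₀ (interior_subset (hseg ⟨1 - ‖p₀‖ / σ, ‖p₀‖ / σ, ?_, by positivity, by ring, ?_⟩))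
    · rwa [sub_pos, div_lt_one hσpos]
    · rw [smul_zero, zero_add, hq₀, smul_smul, div_mul_div_cancel₀ hσpos.ne',
        div_self hp₀pos.ne', one_smul]
  obtain ⟨δ, hδ, hcap⟩ := Metric.isOpen_iff.1 isClosed_closure.isOpen_compl q₀ hq₀closure
  obtain ⟨N, hN⟩ := exists_sphere_subset_spread_ball (E := EuclideanSpace ℝ (Fin n)) σ hδ
  obtain ⟨us, -, hcover⟩ := hN q₀ hq₀σ
  refine ⟨us, fun p hp => mem_ball_zero_iff.2 (not_le.1 fun hle => ?_)⟩
  have hppos : 0 < ‖p‖ := hσpos.trans_le hle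
  have hsphere : (σ / ‖p‖) • p ∈ sphere 0 σ := by
    rw [mem_sphere_zero_iff_norm, norm_smul, Real.norm_of_nonneg (by positivity),
      div_mul_cancel₀ _ hppos.ne']
  have hnot : (σ / ‖p‖) • p ∈ (fenchelDom (listMinkSym us ψ))ᶜ := by
    rw [h.compl_fenchelDom_listMinkSym]
    exact spread_mono us (hcap.trans (Set.compl_subset_compl.2 subset_closure)) (hcover hsphere)
  have hus := h.listMinkSym us
  exact hnot (hus.convexOn_fenchelConj.1.smul_mem_of_zero_mem
    (interior_subset hus.zero_mem_interior_fenchelDom) hp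
    ⟨by positivity, (div_le_one hppos).2 hle⟩)

end ListMinkSym

section Directions

lemma exists_seq_of_prefix {U : Type*} {P : ℕ → List U} (hpre : ∀ k, P k <+: P (k + 1))
    (hlen : ∀ k, k ≤ (P k).length) :
    ∃ u : ℕ → U, ∀ k, (List.range (P k).length).map u = P k := by
  have hmono : ∀ k l, k ≤ l → P k <+: P l := fun k l hkl => by
    induction l, hkl using Nat.le_induction with
    | base => exact List.prefix_rfl
    | succ l _ ih => exact ih.trans (hpre l)
  refine ⟨fun i => (P (i + 1))[i]'(hlen (i + 1)), fun k => ?_⟩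
  refine List.ext_getElem (by rw [List.length_map, List.length_range]) fun i hi hi' => ?_
  rw [List.getElem_map, List.getElem_range]
  rcases le_total (i + 1) k with hik | hik
  · exact (hmono _ _ hik).getElem _
  · exact ((hmono _ _ hik).getElem _).symm

theorem exists_seq_eventually_of_attainable {U ι : Type*} [Nonempty U] [Countable ι]
    {goal : ι → List U → Prop} (hattain : ∀ i us, ∃ vs, goal i (us ++ vs))
    (hpersist : ∀ i us u, goal i us → goal i (us ++ [u])) :
    ∃ u : ℕ → U, ∀ i, ∀ᶠ m in atTop, goal i ((List.range m).map u) := by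
  rcases isEmpty_or_nonempty ι with _ | _
  · exact ⟨fun _ => Classical.arbitrary U, isEmptyElim⟩
  obtain ⟨g, hg⟩ := exists_surjective_nat ι
  choose ext hext using hattain
  let e := Classical.arbitrary U
  -- The extra `e` makes the lists exhaust the sequence.
  let P : ℕ → List U := fun k => Nat.rec [] (fun k l => (l ++ [e]) ++ ext (g k) (l ++ [e])) k
  have hsucc : ∀ k, P (k + 1) = (P k ++ [e]) ++ ext (g k) (P k ++ [e]) := fun _ => rfl
  obtain ⟨u, hu⟩ := exists_seq_of_prefix (P := P)
    (fun k => by rw [hsucc, List.append_assoc]; exact List.prefix_append _ _)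
    (fun k => by
      induction k with
      | zero => exact Nat.zero_le _
      | succ k ih =>
        rw [hsucc, List.length_append, List.length_append, List.length_singleton]
        omega)
  refine ⟨u, fun i => ?_⟩
  obtain ⟨k, rfl⟩ := hg i
  filter_upwards [eventually_ge_atTop (P (k + 1)).length] with m hm
  induction m, hm using Nat.le_induction with
  | base =>
    rw [hu (k + 1), hsucc]
    exact hext _ _
  | succ m _ ih =>
    rw [List.range_succ, List.map_append, List.map_singleton]
    exact hpersist _ _ _ ih

variable {n : ℕ} {ψ : EuclideanSpace ℝ (Fin n) → EReal}

lemma listMinkSym_append (us vs : List (sphere (0 : EuclideanSpace ℝ (Fin n)) 1))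
    (ψ : EuclideanSpace ℝ (Fin n) → EReal) :
    listMinkSym (us ++ vs) ψ = listMinkSym vs (listMinkSym us ψ) :=
  List.foldl_append

lemma iterMinkSym_eq_listMinkSym (u : ℕ → sphere (0 : EuclideanSpace ℝ (Fin n)) 1) (m : ℕ) :
    iterMinkSym (fun i => (u i : EuclideanSpace ℝ (Fin n))) ψ m =
      listMinkSym ((List.range m).map u) ψ := by
  induction m with
  | zero => rfl
  | succ m ih =>
    rw [List.range_succ, List.map_append, listMinkSym_append, ← ih]
    rfl

lemma IsConvC.fenchelDom_listMinkSym_subset (h : IsConvC ψ)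
    (us : List (sphere (0 : EuclideanSpace ℝ (Fin n)) 1)) :
    fenchelDom (listMinkSym us ψ) ⊆ fenchelDom ψ := by
  rw [← Set.compl_subset_compl, h.compl_fenchelDom_listMinkSym]
  exact subset_spread us _

/-- Along the directions `u`, the conjugates of the symmetrals of `ψ` become asymptotically radial
on balls inside the domain of the conjugate of `ψ`, and these domains shrink to the largest such
ball. -/
structure Symmetrizes (u : ℕ → EuclideanSpace ℝ (Fin n)) (ψ : EuclideanSpace ℝ (Fin n) → EReal) :
    Prop where
  sphereOscLE : ∀ {r ρ ε : ℝ}, r < ρ → ball 0 ρ ⊆ fenchelDom ψ → 0 < ε →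
    ∀ᶠ m in atTop, ∀ s ∈ Set.Icc 0 r, SphereOscLE (fenchelConj (iterMinkSym u ψ m)) s ε
  fenchelDom_subset : ∀ {σ : ℝ}, ¬ ball 0 σ ⊆ fenchelDom ψ →
    ∀ᶠ m in atTop, fenchelDom (iterMinkSym u ψ m) ⊆ ball 0 σ

lemma IsConvC.exists_seq_eventually_sphereOscLE [NeZero n] (h : IsConvC ψ) :
    ∃ u : ℕ → sphere (0 : EuclideanSpace ℝ (Fin n)) 1,
      (∀ (r : ℚ) (k : ℕ), closedBall 0 (r : ℝ) ⊆ interior (fenchelDom ψ) → ∀ᶠ m in atTop,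
        ∀ s ∈ Set.Icc 0 (r : ℝ), SphereOscLE
          (meanAlong ((List.range m).map u) (fenchelConj ψ)) s (1 / (k + 1))) ∧
      ∀ σ : ℚ, ¬ ball 0 (σ : ℝ) ⊆ fenchelDom ψ → ∀ᶠ m in atTop,
        fenchelDom (listMinkSym ((List.range m).map u) ψ) ⊆ ball 0 σ := by
  have : Nonempty (sphere (0 : EuclideanSpace ℝ (Fin n)) 1) :=
    (NormedSpace.sphere_nonempty.2 zero_le_one).to_subtype
  let Goal : Type := {r : ℚ // closedBall 0 (r : ℝ) ⊆ interior (fenchelDom ψ)} × ℕ ⊕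
    {σ : ℚ // ¬ ball 0 (σ : ℝ) ⊆ fenchelDom ψ}
  let goal : Goal → List (sphere (0 : EuclideanSpace ℝ (Fin n)) 1) → Prop := fun i us => i.elim
    (fun i => ∀ s ∈ Set.Icc 0 ((i.1 : ℚ) : ℝ),
      SphereOscLE (meanAlong us (fenchelConj ψ)) s (1 / (i.2 + 1)))
    (fun σ => fenchelDom (listMinkSym us ψ) ⊆ ball 0 ((σ : ℚ) : ℝ))
  obtain ⟨u, hu⟩ : ∃ u : ℕ → sphere (0 : EuclideanSpace ℝ (Fin n)) 1, ∀ i, ∀ᶠ m in atTop,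
      goal i ((List.range m).map u) := by
    refine exists_seq_eventually_of_attainable ?_ ?_
    · rintro (⟨⟨r, hr⟩, k⟩ | ⟨σ, hσ⟩) us
      · have hcont := h.convexOn_fenchelConj.continuousOn_interior.mono hr
        obtain ⟨vs, hvs⟩ := exists_forall_sphereOscLE_meanAlong
          (continuousOn_meanAlong (isReflInvariant_closedBall _) us hcont)
          (Nat.one_div_pos_of_nat (n := k))
        exact ⟨vs, by rwa [← meanAlong_append] at hvs⟩
      · obtain ⟨vs, hvs⟩ := (h.listMinkSym us).exists_fenchelDom_listMinkSym_subset_ball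
          fun hball => hσ (hball.trans (h.fenchelDom_listMinkSym_subset us))
        exact ⟨vs, by rwa [← listMinkSym_append] at hvs⟩
    · rintro (i | σ) us u hus
      · exact fun s hs => (meanAlong_append us [u] _).symm ▸ (hus s hs).meanAlong [u]
      · refine subset_trans ?_ hus
        rw [listMinkSym_append]
        exact (h.listMinkSym us).fenchelDom_listMinkSym_subset [u]
  exact ⟨u, fun r k hr => hu (.inl ⟨⟨r, hr⟩, k⟩), fun σ hσ => hu (.inr ⟨σ, hσ⟩)⟩

theorem IsConvC.exists_symmetrizes [NeZero n] (h : IsConvC ψ) :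
    ∃ u : ℕ → EuclideanSpace ℝ (Fin n), (∀ i, ‖u i‖ = 1) ∧ Symmetrizes u ψ := by
  obtain ⟨u, hosc, hdom⟩ := h.exists_seq_eventually_sphereOscLE
  refine ⟨fun i => u i, fun i => norm_eq_of_mem_sphere (u i), ⟨?_, ?_⟩⟩
  · intro r ρ ε hr hρ hε
    obtain ⟨q, hrq, hqρ⟩ := exists_rat_btwn hr
    obtain ⟨k, hk⟩ := exists_nat_one_div_lt hε
    have hq : closedBall 0 (q : ℝ) ⊆ interior (fenchelDom ψ) :=
      (closedBall_subset_ball hqρ).trans (interior_maximal hρ isOpen_ball)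
    filter_upwards [hosc q k hq] with m hm s hs x hx y hy
    have heq := h.eqOn_fenchelConj_listMinkSym (isReflInvariant_closedBall _) hq
      (fun _ _ => rfl) ((List.range m).map u)
    have hsub : sphere (0 : EuclideanSpace ℝ (Fin n)) s ⊆ closedBall 0 (q : ℝ) :=
      sphere_subset_closedBall.trans (closedBall_subset_closedBall (hs.2.trans hrq.le))
    rw [iterMinkSym_eq_listMinkSym, heq (hsub hx), heq (hsub hy)]
    exact (hm s ⟨hs.1, hs.2.trans hrq.le⟩ x hx y hy).trans hk.le
  · intro σ hσ
    obtain ⟨p, hpσ, hp⟩ := Set.not_subset.1 hσ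
    obtain ⟨q, hpq, hqσ⟩ := exists_rat_btwn (mem_ball_zero_iff.1 hpσ)
    filter_upwards [hdom q fun hq => hp (hq (mem_ball_zero_iff.2 hpq))] with m hm
    rw [iterMinkSym_eq_listMinkSym]
    exact hm.trans (ball_subset_ball hqσ.le)

end Directions

section ReflMeanLimit

variable {E : Type*} [NormedAddCommGroup E] [InnerProductSpace ℝ E] {F : ℕ → E → ℝ} {u : ℕ → E}
  {s ε : ℝ} {m k : ℕ}

lemma SphereOscLE.abs_sub_le (h : SphereOscLE (F m) s ε)
    (hF : ∀ k, Set.EqOn (F (k + 1)) (reflMean (u k) (F k)) (sphere 0 s)) (hk : m ≤ k) :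
    ∀ x ∈ sphere (0 : E) s, ∀ y ∈ sphere (0 : E) s, |F k x - F m y| ≤ ε := by
  induction k, hk using Nat.le_induction with
  | base => exact fun x hx y hy => abs_sub_le_iff.2 ⟨h x hx y hy, h y hy x hx⟩
  | succ k _ ih =>
    intro x hx y hy
    obtain ⟨hle, hge⟩ := abs_sub_le_iff.1 (ih x hx y hy)
    obtain ⟨hle', hge'⟩ := abs_sub_le_iff.1 (ih _ (isReflInvariant_sphere s (u k) x hx) y hy)
    rw [hF k hx, reflMean, abs_sub_le_iff]
    constructor <;> linarith

end ReflMeanLimit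

section LimConj

variable {n : ℕ} {ψ : EuclideanSpace ℝ (Fin n) → EReal} {u : ℕ → EuclideanSpace ℝ (Fin n)}
  {p q : EuclideanSpace ℝ (Fin n)} {r ρ : ℝ}

/-- The largest open ball about the origin inside the domain of the conjugate of `ψ`. -/
def innerBall (ψ : EuclideanSpace ℝ (Fin n) → EReal) : Set (EuclideanSpace ℝ (Fin n)) :=
  {p | ∃ ρ, ‖p‖ < ρ ∧ ball 0 ρ ⊆ fenchelDom ψ}

/-- The pointwise limit of the conjugates of successive Minkowski symmetrals of `ψ`, with a junk
value where they do not converge. -/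
def limConj (u : ℕ → EuclideanSpace ℝ (Fin n)) (ψ : EuclideanSpace ℝ (Fin n) → EReal)
    (p : EuclideanSpace ℝ (Fin n)) : ℝ :=
  limUnder atTop fun m => fenchelConj (iterMinkSym u ψ m) p

lemma mem_innerBall_of_norm_eq (hp : p ∈ innerBall ψ) (hq : ‖q‖ = ‖p‖) : q ∈ innerBall ψ :=
  let ⟨ρ, hpρ, hρ⟩ := hp
  ⟨ρ, hq.trans_lt hpρ, hρ⟩

lemma IsConvC.ball_subset_fenchelDom_iterMinkSym (h : IsConvC ψ)
    (u : ℕ → EuclideanSpace ℝ (Fin n)) (hρ : ball 0 ρ ⊆ fenchelDom ψ) (m : ℕ) :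
    ball 0 ρ ⊆ fenchelDom (iterMinkSym u ψ m) := by
  induction m with
  | zero => exact hρ
  | succ m ih =>
    rw [iterMinkSym, (h.iterMinkSym u m).fenchelDom_minkSym]
    refine Set.subset_inter ih fun p hp => ih ?_
    rwa [mem_ball_zero_iff, LinearIsometryEquiv.norm_map, ← mem_ball_zero_iff]

lemma IsConvC.innerBall_subset_fenchelDom_iterMinkSym (h : IsConvC ψ)
    (u : ℕ → EuclideanSpace ℝ (Fin n)) (m : ℕ) :
    innerBall ψ ⊆ fenchelDom (iterMinkSym u ψ m) := fun _ ⟨_, hpρ, hρ⟩ =>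
  h.ball_subset_fenchelDom_iterMinkSym u hρ m (mem_ball_zero_iff.2 hpρ)

lemma IsConvC.eqOn_fenchelConj_iterMinkSym_succ (h : IsConvC ψ)
    (u : ℕ → EuclideanSpace ℝ (Fin n)) (hρ : ball 0 ρ ⊆ fenchelDom ψ) (m : ℕ) :
    Set.EqOn (fenchelConj (iterMinkSym u ψ (m + 1)))
      (reflMean (u m) (fenchelConj (iterMinkSym u ψ m))) (ball 0 ρ) := fun p hp => by
  have hball := h.ball_subset_fenchelDom_iterMinkSym u hρ m
  refine (h.iterMinkSym u m).fenchelConj_minkSym (hball hp) (hball ?_)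
  rwa [mem_ball_zero_iff, LinearIsometryEquiv.norm_map, ← mem_ball_zero_iff]

theorem Symmetrizes.uniformCauchySeqOn_fenchelConj (hu : Symmetrizes u ψ) (h : IsConvC ψ)
    (hr : r < ρ) (hρ : ball 0 ρ ⊆ fenchelDom ψ) :
    UniformCauchySeqOn (fun m => fenchelConj (iterMinkSym u ψ m)) atTop (closedBall 0 r) := by
  rw [Metric.uniformCauchySeqOn_iff]
  intro ε hε
  obtain ⟨N, hN⟩ := (hu.sphereOscLE hr hρ (div_pos hε three_pos)).exists
  have near_N : ∀ k ≥ N, ∀ p ∈ closedBall (0 : EuclideanSpace ℝ (Fin n)) r,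
      dist (fenchelConj (iterMinkSym u ψ k) p) (fenchelConj (iterMinkSym u ψ N) p) ≤ ε / 3 := by
    intro k hk p hp
    rw [mem_closedBall_zero_iff] at hp
    have hsub : sphere (0 : EuclideanSpace ℝ (Fin n)) ‖p‖ ⊆ ball 0 ρ := fun x hx =>
      mem_ball_zero_iff.2 ((mem_sphere_zero_iff_norm.1 hx).trans_lt (hp.trans_lt hr))
    exact (hN ‖p‖ ⟨norm_nonneg p, hp⟩).abs_sub_le
      (F := fun m => fenchelConj (iterMinkSym u ψ m))
      (fun m => (h.eqOn_fenchelConj_iterMinkSym_succ u hρ m).mono hsub) hk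
      p (mem_sphere_zero_iff_norm.2 rfl) p (mem_sphere_zero_iff_norm.2 rfl)
  refine ⟨N, fun k hk l hl p hp => ?_⟩
  have htri := dist_triangle_right (fenchelConj (iterMinkSym u ψ k) p)
    (fenchelConj (iterMinkSym u ψ l) p) (fenchelConj (iterMinkSym u ψ N) p)
  linarith [near_N k hk p hp, near_N l hl p hp]

lemma Symmetrizes.tendsto_fenchelConj (hu : Symmetrizes u ψ) (h : IsConvC ψ)
    (hp : p ∈ innerBall ψ) :
    Tendsto (fun m => fenchelConj (iterMinkSym u ψ m) p) atTop (𝓝 (limConj u ψ p)) := by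
  obtain ⟨ρ, hpρ, hρ⟩ := hp
  exact ((hu.uniformCauchySeqOn_fenchelConj h hpρ hρ).cauchySeq
    (mem_closedBall_zero_iff.2 le_rfl)).tendsto_limUnder

theorem Symmetrizes.tendstoUniformlyOn_fenchelConj (hu : Symmetrizes u ψ) (h : IsConvC ψ)
    (hr : r < ρ) (hρ : ball 0 ρ ⊆ fenchelDom ψ) :
    TendstoUniformlyOn (fun m => fenchelConj (iterMinkSym u ψ m)) (limConj u ψ) atTop
      (closedBall 0 r) :=
  (hu.uniformCauchySeqOn_fenchelConj h hr hρ).tendstoUniformlyOn_of_tendsto fun _ hp =>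
    hu.tendsto_fenchelConj h ⟨ρ, (mem_closedBall_zero_iff.1 hp).trans_lt hr, hρ⟩

lemma Symmetrizes.limConj_eq_of_norm_eq (hu : Symmetrizes u ψ) (h : IsConvC ψ)
    (hp : p ∈ innerBall ψ) (hq : ‖q‖ = ‖p‖) : limConj u ψ q = limConj u ψ p := by
  have limConj_le : ∀ p ∈ innerBall ψ, ∀ q, ‖q‖ = ‖p‖ → limConj u ψ q ≤ limConj u ψ p := by
    intro p hp q hq
    refine le_of_forall_pos_le_add fun ε hε => ?_
    refine le_of_tendsto_of_tendsto (hu.tendsto_fenchelConj h (mem_innerBall_of_norm_eq hp hq))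
      ((hu.tendsto_fenchelConj h hp).add_const ε) ?_
    obtain ⟨ρ, hpρ, hρ⟩ := hp
    filter_upwards [hu.sphereOscLE hpρ hρ hε] with m hm
    linarith [hm ‖p‖ ⟨norm_nonneg p, le_rfl⟩ q (mem_sphere_zero_iff_norm.2 hq) p
      (mem_sphere_zero_iff_norm.2 rfl)]
  exact le_antisymm (limConj_le p hp q hq)
    (limConj_le q (mem_innerBall_of_norm_eq hp hq) p hq.symm)

lemma IsConvC.fenchelConj_iterMinkSym_zero (h : IsConvC ψ) (u : ℕ → EuclideanSpace ℝ (Fin n))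
    (m : ℕ) : fenchelConj (iterMinkSym u ψ m) 0 = fenchelConj ψ 0 := by
  induction m with
  | zero => rfl
  | succ m ih =>
    have h0 := interior_subset (h.iterMinkSym u m).zero_mem_interior_fenchelDom
    rw [iterMinkSym, (h.iterMinkSym u m).fenchelConj_minkSym h0 (by rwa [map_zero]), map_zero, ih,
      add_self_div_two]

lemma IsConvC.zero_mem_innerBall (h : IsConvC ψ) : 0 ∈ innerBall ψ := by
  obtain ⟨ρ, hρ, hball⟩ := Metric.isOpen_iff.1 isOpen_interior 0 h.zero_mem_interior_fenchelDom
  exact ⟨ρ, norm_zero.trans_lt hρ, hball.trans interior_subset⟩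

/-- The limit is radial, so its value at `p` is the mean of those at `p` and `-p`. -/
lemma Symmetrizes.limConj_zero_le (hu : Symmetrizes u ψ) (h : IsConvC ψ) (hp : p ∈ innerBall ψ) :
    limConj u ψ 0 ≤ limConj u ψ p := by
  have hneg : -p ∈ innerBall ψ := mem_innerBall_of_norm_eq hp (norm_neg p)
  have hmean : limConj u ψ p =
      (1 / 2 : ℝ) • limConj u ψ p + (1 / 2 : ℝ) • limConj u ψ (-p) := by
    rw [hu.limConj_eq_of_norm_eq h hp (norm_neg p), ← add_smul, add_halves, one_smul]
  rw [hmean]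
  refine le_of_tendsto_of_tendsto' (hu.tendsto_fenchelConj h h.zero_mem_innerBall)
    (((hu.tendsto_fenchelConj h hp).const_smul _).add
      ((hu.tendsto_fenchelConj h hneg).const_smul _)) fun m => ?_
  have hmid := (h.iterMinkSym u m).convexOn_fenchelConj.2
    (h.innerBall_subset_fenchelDom_iterMinkSym u m hp)
    (h.innerBall_subset_fenchelDom_iterMinkSym u m hneg)
    one_half_pos.le one_half_pos.le (add_halves 1)
  rwa [smul_neg, add_neg_cancel] at hmid

end LimConj

section ConjOn

variable {E : Type*} [NormedAddCommGroup E] [InnerProductSpace ℝ E] {B : Set E} {α : E → ℝ} {p : E}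

/-- The conjugate `x ↦ sup_{p ∈ B} (⟨p, x⟩ - α p)` of the function which is `α` on `B` and `+∞`
elsewhere. -/
def conjOn (B : Set E) (α : E → ℝ) (x : E) : EReal :=
  ⨆ p : B, ((inner ℝ (p : E) x - α p : ℝ) : EReal)

lemma conjOn_le_iff {x : E} {t : ℝ} : conjOn B α x ≤ t ↔ ∀ p ∈ B, inner ℝ p x - α p ≤ t := by
  simp only [conjOn, iSup_le_iff, EReal.coe_le_coe_iff, Subtype.forall]

lemma le_conjOn (hp : p ∈ B) (x : E) : ((inner ℝ p x - α p : ℝ) : EReal) ≤ conjOn B α x :=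
  le_iSup (fun p : B => ((inner ℝ (p : E) x - α p : ℝ) : EReal)) ⟨p, hp⟩

lemma lowerSemicontinuous_conjOn : LowerSemicontinuous (conjOn B α) :=
  lowerSemicontinuous_iSup fun p =>
    (continuous_coe_real_ereal.comp (by fun_prop :
      Continuous fun x => inner ℝ (p : E) x - α p)).lowerSemicontinuous

lemma convex_epigraph_conjOn : Convex ℝ (epigraph (conjOn B α)) := by
  rintro ⟨x, s⟩ hx ⟨y, t⟩ hy a b ha hb hab
  refine conjOn_le_iff.2 fun p hp => ?_
  calc inner ℝ p (a • x + b • y) - α p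
      = a * (inner ℝ p x - α p) + b * (inner ℝ p y - α p) := by
        rw [inner_add_right, real_inner_smul_right, real_inner_smul_right]
        linear_combination (α p) * hab
    _ ≤ a * s + b * t := by
        gcongr
        exacts [conjOn_le_iff.1 hx p hp, conjOn_le_iff.1 hy p hp]

lemma conjOn_map (hB : ∀ p ∈ B, ∀ q, ‖q‖ = ‖p‖ → q ∈ B)
    (hα : ∀ p ∈ B, ∀ q, ‖q‖ = ‖p‖ → α q = α p) (A : E ≃ₗᵢ[ℝ] E) (x : E) :
    conjOn B α (A x) = conjOn B α x := by
  have conjOn_map_le : ∀ (A : E ≃ₗᵢ[ℝ] E) x, conjOn B α (A x) ≤ conjOn B α x := by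
    refine fun A x => iSup_le fun p => ?_
    have hnorm : ‖A.symm p‖ = ‖(p : E)‖ := A.symm.norm_map _
    rw [← hα p p.2 _ hnorm, ← A.symm.inner_map_map p, A.symm_apply_apply]
    exact le_conjOn (hB p p.2 _ hnorm) x
  refine le_antisymm (conjOn_map_le A x) ?_
  simpa only [A.symm_apply_apply] using conjOn_map_le A.symm (A x)

lemma linearGrowth_conjOn [Nontrivial E] {a c : ℝ} (ha : 0 ≤ a) (hB : sphere 0 a ⊆ B)
    (hα : ∀ p ∈ sphere (0 : E) a, α p ≤ c) : LinearGrowth (conjOn B α) a (-c) := fun x => by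
  obtain ⟨e, he, hx⟩ : ∃ e : E, ‖e‖ = 1 ∧ inner ℝ e x = ‖x‖ := by
    rcases eq_or_ne x 0 with rfl | hx
    · obtain ⟨e, he⟩ := exists_norm_eq E zero_le_one
      exact ⟨e, he, by rw [inner_zero_right, norm_zero]⟩
    · refine ⟨(‖x‖⁻¹ : ℝ) • x, norm_smul_inv_norm hx, ?_⟩
      rw [real_inner_smul_left, real_inner_self_eq_norm_mul_norm,
        inv_mul_cancel_left₀ (norm_ne_zero_iff.2 hx)]
  have hp : a • e ∈ sphere (0 : E) a := by
    rw [mem_sphere_zero_iff_norm, norm_smul, he, mul_one, Real.norm_of_nonneg ha]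
  refine le_trans (EReal.coe_le_coe_iff.2 ?_) (le_conjOn (hB hp) x)
  rw [real_inner_smul_left, hx]
  linarith [hα _ hp]

end ConjOn

section NormCone

open scoped Pointwise

variable {E : Type*} [NormedAddCommGroup E] {ψ : E → EReal} {x : E} {b t ε k : ℝ}

/-- The cone of slope `k` in `E × ℝ`; adding it to an epigraph gives the epigraph of the
`k`-Lipschitz regularization. -/
def normCone (E : Type*) [NormedAddCommGroup E] (k : ℝ) : Set (E × ℝ) :=
  {w | k * ‖w.1‖ ≤ w.2}

lemma convex_normCone [NormedSpace ℝ E] (hk : 0 ≤ k) : Convex ℝ (normCone E k) := by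
  rintro ⟨v, s⟩ hv ⟨w, r⟩ hw a b ha hb -
  calc k * ‖a • v + b • w‖ ≤ k * (‖a • v‖ + ‖b • w‖) := by gcongr; exact norm_add_le _ _
    _ = a * (k * ‖v‖) + b * (k * ‖w‖) := by
        rw [norm_smul, norm_smul, Real.norm_of_nonneg ha, Real.norm_of_nonneg hb]
        ring
    _ ≤ a * s + b * r := by
        gcongr
        exacts [hv, hw]

lemma disjoint_ball_prod_Iio_epigraph_add_normCone (hε : 0 < ε)
    (hb : ∀ y (s : ℝ), ψ y ≤ s → b ≤ s) (hx : ∀ y ∈ ball x ε, ¬ ψ y ≤ t) :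
    Disjoint (ball x (ε / 2) ×ˢ Set.Iio t)
      (epigraph ψ + normCone E (|t - b| / (ε / 2))) := by
  rw [Set.disjoint_left]
  rintro _ ⟨hz, hzt⟩ ⟨⟨y, s⟩, hy, ⟨w, r⟩, hw, rfl⟩
  have hst : s + r < t := hzt
  have hcone : |t - b| / (ε / 2) * ‖w‖ ≤ r := hw
  have hyx : ε ≤ ‖y - x‖ := by
    by_contra! hlt
    have hr : 0 ≤ r := le_trans (by positivity) hcone
    exact hx y (mem_ball_iff_norm.2 hlt) (le_trans hy (EReal.coe_le_coe_iff.2 (by linarith)))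
  have hwε : ε / 2 ≤ ‖w‖ := by
    have hywx : ‖y + w - x‖ < ε / 2 := mem_ball_iff_norm.1 hz
    have htri : ‖y - x‖ ≤ ‖y + w - x‖ + ‖w‖ := by
      simpa only [show y + w - x - w = y - x by abel] using norm_sub_le (y + w - x) w
    linarith
  have hbr : t - b ≤ r := calc
    t - b ≤ |t - b| / (ε / 2) * (ε / 2) := by
      rw [div_mul_cancel₀ _ (half_pos hε).ne']
      exact le_abs_self _
    _ ≤ |t - b| / (ε / 2) * ‖w‖ := by gcongr
    _ ≤ r := hcone
  linarith [hb y s hy]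

end NormCone

section AffineMinorant

open scoped Pointwise

variable {E : Type*} [NormedAddCommGroup E] [InnerProductSpace ℝ E] {ψ : E → EReal} {x : E}
  {b t ε : ℝ}

lemma exists_inner_add_mul [CompleteSpace E] (f : StrongDual ℝ (E × ℝ)) :
    ∃ (q : E) (β : ℝ), ∀ y s, f (y, s) = inner ℝ q y + s * β := by
  refine ⟨(InnerProductSpace.toDual ℝ _).symm (f.comp (.inl ℝ E ℝ)), f (0, 1), fun y s => ?_⟩
  rw [InnerProductSpace.toDual_symm_apply, ← smul_eq_mul, ← map_smul,
    ContinuousLinearMap.comp_apply, ← map_add, ContinuousLinearMap.inl_apply, Prod.smul_mk,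
    smul_zero, smul_eq_mul, mul_one, Prod.mk_add_mk, add_zero, zero_add]

/-- Enlarging the epigraph by a cone rules out vertical separating hyperplanes. -/
theorem exists_affine_separation [CompleteSpace E] (hconv : Convex ℝ (epigraph ψ))
    (hne : (epigraph ψ).Nonempty) (hε : 0 < ε) (hb : ∀ y (s : ℝ), ψ y ≤ s → b ≤ s)
    (hx : ∀ y ∈ ball x ε, ¬ ψ y ≤ t) :
    ∃ p : E, ∀ y' ∈ ball x (ε / 2), ∀ y (s : ℝ), ψ y ≤ s → inner ℝ p y - s ≤ inner ℝ p y' - t := by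
  set k := |t - b| / (ε / 2)
  have hk : 0 ≤ k := by positivity
  obtain ⟨f, v, hf_lt, hle_f⟩ := geometric_hahn_banach_open
    ((convex_ball x (ε / 2)).prod (convex_Iio t)) (isOpen_ball.prod isOpen_Iio)
    (hconv.add (convex_normCone hk)) (disjoint_ball_prod_Iio_epigraph_add_normCone hε hb hx)
  obtain ⟨q, β, hf⟩ := exists_inner_add_mul f
  have hsep : ∀ y' ∈ ball x (ε / 2), ∀ s' < t, ∀ y (s : ℝ), ψ y ≤ s → ∀ w r, k * ‖w‖ ≤ r →
      inner ℝ q y' + s' * β < inner ℝ q (y + w) + (s + r) * β := by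
    intro y' hy' s' hs' y s hy w r hw
    rw [← hf, ← hf]
    exact (hf_lt (y', s') ⟨hy', hs'⟩).trans_le
      (hle_f _ (Set.add_mem_add (a := (y, s)) (b := (w, r)) hy hw))
  have hβ : 0 < β := by
    obtain ⟨⟨y, s⟩, hy⟩ := hne
    have hlt := hsep x (mem_ball_self (half_pos hε)) (min (t - 1) s)
      ((min_le_left _ _).trans_lt (sub_one_lt t)) y s hy (x - y) (k * ‖x - y‖) le_rfl
    rw [add_sub_cancel, add_lt_add_iff_left] at hlt
    by_contra! hβ
    have hr : 0 ≤ k * ‖x - y‖ := by positivity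
    exact hlt.not_ge (mul_le_mul_of_nonpos_right (by linarith [min_le_right (t - 1) s]) hβ)
  refine ⟨-(β⁻¹ • q), fun y' hy' y s hy => ?_⟩
  suffices t ≤ s + β⁻¹ * (inner ℝ q y - inner ℝ q y') by
    rw [inner_neg_left, inner_neg_left, real_inner_smul_left, real_inner_smul_left]
    linarith
  refine le_of_forall_lt fun s' hs' => ?_
  have hlt := hsep y' hy' s' hs' y s hy 0 0 (by rw [norm_zero, mul_zero])
  rw [add_zero, add_zero] at hlt
  refine lt_of_mul_lt_mul_right ?_ hβ.le
  rw [add_mul, mul_right_comm, inv_mul_cancel₀ hβ.ne', one_mul]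
  linarith

theorem exists_fenchelConj_le [CompleteSpace E] (hconv : Convex ℝ (epigraph ψ))
    (hne : (epigraph ψ).Nonempty) (hε : 0 < ε) (hb : ∀ y (s : ℝ), ψ y ≤ s → b ≤ s)
    (hx : ∀ y ∈ ball x ε, ¬ ψ y ≤ t) :
    ∃ p ∈ fenchelDom ψ, fenchelConj ψ p ≤ inner ℝ p x - t - ε / 4 * ‖p‖ := by
  obtain ⟨p, hp⟩ := exists_affine_separation hconv hne hε hb hx
  set e : E := (‖p‖⁻¹ : ℝ) • p with he
  have he_norm : ‖e‖ ≤ 1 := by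
    rw [he, norm_smul, norm_inv, norm_norm]
    exact inv_mul_le_one
  have he_inner : inner ℝ p e = ‖p‖ := by
    rw [he, real_inner_smul_right, real_inner_self_eq_norm_mul_norm, ← mul_assoc]
    exact inv_mul_mul_self _
  have hmem : x - (ε / 4) • e ∈ ball x (ε / 2) := by
    rw [mem_ball_iff_norm, sub_sub_cancel_left, norm_neg, norm_smul,
      Real.norm_of_nonneg (by positivity)]
    nlinarith
  have hle : ∀ y (s : ℝ), ψ y ≤ s → inner ℝ p y - s ≤ inner ℝ p x - t - ε / 4 * ‖p‖ := by
    intro y s hy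
    have := hp _ hmem y s hy
    rw [inner_sub_right, real_inner_smul_right, he_inner] at this
    linarith
  exact ⟨p, mem_fenchelDom_of_forall_le hle, fenchelConj_le hne hle⟩

end AffineMinorant

section Selection

lemma exists_seq_mem_tendsto {X : Type*} [PseudoMetricSpace X] {A : ℕ → Set X} {x : X}
    (hne : ∀ m, (A m).Nonempty) (h : ∀ ε > 0, ∀ᶠ m in atTop, ∃ y ∈ A m, dist y x < ε) :
    ∃ y : ℕ → X, (∀ m, y m ∈ A m) ∧ Tendsto y atTop (𝓝 x) := by
  choose y hyA hy using fun m : ℕ => (infDist_lt_iff (hne m)).1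
    (lt_add_of_pos_right (infDist x (A m)) (Nat.one_div_pos_of_nat (α := ℝ) (n := m)))
  refine ⟨y, hyA, Metric.tendsto_nhds.2 fun ε hε => ?_⟩
  filter_upwards [h (ε / 2) (half_pos hε),
    tendsto_one_div_add_atTop_nhds_zero_nat.eventually_lt_const (half_pos hε)]
    with m ⟨z, hz, hzx⟩ hm
  calc dist (y m) x = dist x (y m) := dist_comm _ _
    _ < infDist x (A m) + 1 / (m + 1) := hy m
    _ ≤ dist x z + 1 / (m + 1) := by gcongr; exact infDist_le_dist_of_mem hz
    _ < ε := by rw [dist_comm]; linarith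

end Selection

section Truncation

variable {E : Type*} [NormedAddCommGroup E] [InnerProductSpace ℝ E]

/-- A point `p` outside the ball of radius `r` is replaced by `(r / ‖p‖) • p`; the term `κ * ‖p‖`
pays for the value at the origin that enters by convexity. -/
lemma exists_norm_le_and_le_inner_sub {D : Set E} {F : E → ℝ} (hF : ConvexOn ℝ D F) (h0 : 0 ∈ D)
    {p x : E} {r t κ : ℝ} (hr : 0 < r) (hκ : 0 ≤ κ) (hp : p ∈ D)
    (hFp : F p ≤ inner ℝ p x - t - κ * ‖p‖)
    (hpr : r ≤ ‖p‖ → (‖p‖ - r) * |F 0 + t| ≤ κ * r * ‖p‖) :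
    ∃ q, ‖q‖ ≤ r ∧ F q ≤ inner ℝ q x - t := by
  rcases le_or_gt ‖p‖ r with hle | hlt
  · have : 0 ≤ κ * ‖p‖ := by positivity
    exact ⟨p, hle, by linarith⟩
  have hp0 : 0 < ‖p‖ := hr.trans hlt
  set l := r / ‖p‖
  have hl0 : 0 ≤ l := by positivity
  have hl1 : 0 ≤ 1 - l := sub_nonneg.2 ((div_le_one hp0).2 hlt.le)
  have hlp : l * ‖p‖ = r := div_mul_cancel₀ r hp0.ne'
  have hpay : (1 - l) * (F 0 + t) ≤ κ * r := by
    refine (mul_le_mul_of_nonneg_left (le_abs_self _) hl1).trans ?_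
    refine le_of_mul_le_mul_right ?_ hp0
    calc (1 - l) * |F 0 + t| * ‖p‖ = (‖p‖ - l * ‖p‖) * |F 0 + t| := by ring
      _ ≤ κ * r * ‖p‖ := by rw [hlp]; exact hpr hlt.le
  refine ⟨l • p, ?_, ?_⟩
  · rw [norm_smul, Real.norm_of_nonneg hl0, hlp]
  · calc F (l • p) = F ((1 - l) • 0 + l • p) := by rw [smul_zero, zero_add]
      _ ≤ (1 - l) * F 0 + l * F p := hF.2 h0 hp hl1 hl0 (sub_add_cancel 1 l)
      _ ≤ (1 - l) * F 0 + l * (inner ℝ p x - t - κ * ‖p‖) := by gcongr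
      _ = l * inner ℝ p x - t + ((1 - l) * (F 0 + t) - κ * (l * ‖p‖)) := by ring
      _ ≤ inner ℝ (l • p) x - t := by
        rw [hlp, real_inner_smul_left]
        linarith

end Truncation

section EpiLimit

variable {n : ℕ} {ψ : EuclideanSpace ℝ (Fin n) → EReal} {u : ℕ → EuclideanSpace ℝ (Fin n)}
  {x : EuclideanSpace ℝ (Fin n)} {s t ε : ℝ}

/-- The epi-limit of the successive Minkowski symmetrals of `ψ` in directions `u` symmetrizing
`ψ`: the conjugate of the radial limit of their conjugates. -/
def symLimit (u : ℕ → EuclideanSpace ℝ (Fin n)) (ψ : EuclideanSpace ℝ (Fin n) → EReal) :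
    EuclideanSpace ℝ (Fin n) → EReal :=
  conjOn (innerBall ψ) (limConj u ψ)

lemma Symmetrizes.symLimit_map (hu : Symmetrizes u ψ) (h : IsConvC ψ)
    (A : EuclideanSpace ℝ (Fin n) ≃ₗᵢ[ℝ] EuclideanSpace ℝ (Fin n)) (x : EuclideanSpace ℝ (Fin n)) :
    symLimit u ψ (A x) = symLimit u ψ x :=
  conjOn_map (fun _ hp _ => mem_innerBall_of_norm_eq hp)
    (fun _ hp _ => hu.limConj_eq_of_norm_eq h hp) A x

theorem Symmetrizes.isConvC_symLimit [NeZero n] (hu : Symmetrizes u ψ) (h : IsConvC ψ) :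
    IsConvC (symLimit u ψ) := by
  obtain ⟨ρ, hρ, hball⟩ := h.zero_mem_innerBall
  rw [norm_zero] at hρ
  obtain ⟨e, he⟩ := exists_norm_eq (EuclideanSpace ℝ (Fin n)) (half_pos hρ).le
  have hmem : ∀ p ∈ sphere (0 : EuclideanSpace ℝ (Fin n)) (ρ / 2), p ∈ innerBall ψ := fun p hp =>
    ⟨ρ, (mem_sphere_zero_iff_norm.1 hp).trans_lt (half_lt_self hρ), hball⟩
  have hgrowth : LinearGrowth (symLimit u ψ) (ρ / 2) (-limConj u ψ e) :=
    linearGrowth_conjOn (half_pos hρ).le hmem fun p hp =>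
      (hu.limConj_eq_of_norm_eq h (hmem e (mem_sphere_zero_iff_norm.2 he))
        ((mem_sphere_zero_iff_norm.1 hp).trans he.symm)).le
  have hzero : symLimit u ψ 0 ≤ ((-limConj u ψ 0 : ℝ) : EReal) :=
    conjOn_le_iff.2 fun p hp => by
      rw [inner_zero_right]
      linarith [hu.limConj_zero_le h hp]
  exact
    { convex := convex_epigraph_conjOn
      ne_bot := hgrowth.ne_bot
      dom_nonempty := ⟨0, hzero.trans_lt (EReal.coe_lt_top _)⟩
      lsc := lowerSemicontinuous_conjOn
      coercive := hgrowth.tendsto_cobounded (half_pos hρ) }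

/-- When the domain of the conjugate contains a largest ball, `r` is close to its radius; otherwise
`r` is large. -/
lemma Symmetrizes.exists_radius (hu : Symmetrizes u ψ) (h : IsConvC ψ) {C κ : ℝ} (hC : 0 ≤ C)
    (hκ : 0 < κ) : ∃ r ρ : ℝ, 0 < r ∧ r < ρ ∧ ball 0 ρ ⊆ fenchelDom ψ ∧
      ∀ᶠ m in atTop, ∀ p ∈ fenchelDom (iterMinkSym u ψ m), r ≤ ‖p‖ →
        (‖p‖ - r) * C ≤ κ * r * ‖p‖ := by
  set S : Set ℝ := {ρ | ball 0 ρ ⊆ fenchelDom ψ}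
  by_cases hbdd : BddAbove S
  · obtain ⟨a, ha, haS⟩ := h.zero_mem_innerBall
    rw [norm_zero] at ha
    have hR : 0 < sSup S := ha.trans_le (le_csSup hbdd haS)
    set R := sSup S
    obtain ⟨c, ⟨hcR, hcC⟩, hc : 0 < c⟩ :
        ∃ c, (c < R ∧ 2 * c * C < κ * (R - c) ^ 2) ∧ c ∈ Set.Ioi (0 : ℝ) := by
      have hlim : ∀ᶠ c in 𝓝 (0 : ℝ), c < R ∧ 2 * c * C < κ * (R - c) ^ 2 :=
        (eventually_lt_nhds hR).and <| ContinuousAt.eventually_lt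
          (by fun_prop) (by fun_prop) (by rw [mul_zero, zero_mul, sub_zero]; positivity)
      exact ((hlim.filter_mono nhdsWithin_le_nhds).and self_mem_nhdsWithin).exists
        (f := 𝓝[>] (0 : ℝ))
    obtain ⟨ρ, hρS, hρ⟩ := exists_lt_of_lt_csSup ⟨a, haS⟩ (sub_lt_self R hc)
    have hRc : ¬ ball 0 (R + c) ⊆ fenchelDom ψ := fun hsub =>
      (lt_add_of_pos_right R hc).not_ge (le_csSup hbdd hsub)
    refine ⟨R - c, ρ, sub_pos.2 hcR, hρ, hρS, ?_⟩
    filter_upwards [hu.fenchelDom_subset hRc] with m hm p hp hrp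
    have hpR : ‖p‖ < R + c := mem_ball_zero_iff.1 (hm hp)
    calc (‖p‖ - (R - c)) * C ≤ 2 * c * C := by gcongr; linarith
      _ ≤ κ * (R - c) * (R - c) := by linarith
      _ ≤ κ * (R - c) * ‖p‖ := by
        have : 0 ≤ R - c := (sub_pos.2 hcR).le
        gcongr
  · obtain ⟨ρ, hρS, hρ⟩ := not_bddAbove_iff.1 hbdd (C / κ + 1)
    refine ⟨C / κ + 1, ρ, by positivity, hρ, hρS, Eventually.of_forall fun m p _ _ => ?_⟩
    have hκr : κ * (C / κ + 1) = C + κ := by field_simp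
    rw [hκr]
    nlinarith [norm_nonneg p, show 0 ≤ C / κ + 1 by positivity]

theorem Symmetrizes.eventually_exists_le (hu : Symmetrizes u ψ) (h : IsConvC ψ)
    (hx : symLimit u ψ x ≤ s) (hst : s < t) (hε : 0 < ε) :
    ∀ᶠ m in atTop, ∃ y ∈ ball x ε, iterMinkSym u ψ m y ≤ t := by
  obtain ⟨r, ρ, hr, hrρ, hρ, hrad⟩ :=
    hu.exists_radius h (abs_nonneg (fenchelConj ψ 0 + t)) (div_pos hε four_pos)
  filter_upwards [hrad, Metric.tendstoUniformlyOn_iff.1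
    (hu.tendstoUniformlyOn_fenchelConj h hrρ hρ) (t - s) (sub_pos.2 hst)] with m hm hunif
  by_contra! hfar
  have hφ := h.iterMinkSym u m
  obtain ⟨a, ha, b, hgrowth⟩ := hφ.exists_linearGrowth
  have hb : ∀ y (s : ℝ), iterMinkSym u ψ m y ≤ s → b ≤ s := fun y s hy =>
    (le_add_of_nonneg_left (by positivity)).trans (hgrowth.le hy)
  obtain ⟨p, hpD, hp⟩ := exists_fenchelConj_le hφ.convex hφ.epigraph_nonempty hε hb
    fun y hy => (hfar y hy).not_ge
  obtain ⟨q, hqr, hq⟩ := exists_norm_le_and_le_inner_sub hφ.convexOn_fenchelConj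
    (interior_subset hφ.zero_mem_interior_fenchelDom) hr (div_pos hε four_pos).le hpD hp
    (by rw [h.fenchelConj_iterMinkSym_zero]; exact hm p hpD)
  have hlim := (abs_lt.1 (hunif q (mem_closedBall_zero_iff.2 hqr))).2
  linarith [conjOn_le_iff.1 hx q ⟨ρ, hqr.trans_lt hrρ, hρ⟩]

lemma Symmetrizes.symLimit_le_liminf (hu : Symmetrizes u ψ) (h : IsConvC ψ)
    {y : ℕ → EuclideanSpace ℝ (Fin n)} (hy : Tendsto y atTop (𝓝 x)) :
    symLimit u ψ x ≤ liminf (fun m => iterMinkSym u ψ m (y m)) atTop := by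
  refine iSup_le fun p => ?_
  have hlim : Tendsto (fun m => ((inner ℝ (p : EuclideanSpace ℝ (Fin n)) (y m) -
      fenchelConj (iterMinkSym u ψ m) p : ℝ) : EReal)) atTop
      (𝓝 ((inner ℝ (p : EuclideanSpace ℝ (Fin n)) x - limConj u ψ p : ℝ) : EReal)) :=
    EReal.tendsto_coe.2 ((tendsto_const_nhds.inner hy).sub (hu.tendsto_fenchelConj h p.2))
  rw [← hlim.liminf_eq]
  refine liminf_le_liminf (Eventually.of_forall fun m => ?_)
  refine EReal.le_of_forall_lt_iff_le.1 fun s hs => EReal.coe_le_coe_iff.2 ?_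
  linarith [inner_sub_le_fenchelConj
    (h.innerBall_subset_fenchelDom_iterMinkSym u m p.2) hs.le]

theorem Symmetrizes.epiConverges [NeZero n] (hu : Symmetrizes u ψ) (h : IsConvC ψ) :
    EpiConverges (iterMinkSym u ψ) (symLimit u ψ) := fun x => by
  refine ⟨fun y hy => hu.symLimit_le_liminf h hy, ?_⟩
  suffices ∃ y : ℕ → EuclideanSpace ℝ (Fin n), Tendsto y atTop (𝓝 x) ∧
      limsup (fun m => iterMinkSym u ψ m (y m)) atTop ≤ symLimit u ψ x from
    let ⟨y, hy, hle⟩ := this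
    ⟨y, hy, tendsto_of_le_liminf_of_limsup_le (hu.symLimit_le_liminf h hy) hle⟩
  induction hx : symLimit u ψ x with
  | bot => exact absurd hx ((hu.isConvC_symLimit h).ne_bot x)
  | top => exact ⟨fun _ => x, tendsto_const_nhds, le_top⟩
  | coe c =>
    obtain ⟨z, hz, hlim⟩ := exists_seq_mem_tendsto (x := (x, c))
      (fun m => (h.iterMinkSym u m).epigraph_nonempty) fun ε hε => by
        filter_upwards [hu.eventually_exists_le h hx.le (lt_add_of_pos_right c (half_pos hε)) hε]
          with m ⟨y, hyx, hy⟩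
        refine ⟨(y, c + ε / 2), hy, max_lt hyx ?_⟩
        rw [Real.dist_eq, add_sub_cancel_left, abs_of_pos (half_pos hε)]
        exact half_lt_self hε
    rw [nhds_prod_eq, tendsto_prod_iff'] at hlim
    refine ⟨fun m => (z m).1, hlim.1, ?_⟩
    rw [← (EReal.tendsto_coe.2 hlim.2).limsup_eq]
    exact limsup_le_limsup (Eventually.of_forall hz)

theorem IsConvC.exists_isEpiSymmetrization [NeZero n] (h : IsConvC ψ) :
    ∃ φ, IsEpiSymmetrization ψ φ := by
  obtain ⟨u, hu1, hu⟩ := h.exists_symmetrizes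
  exact ⟨symLimit u ψ, hu.isConvC_symLimit h, hu.symLimit_map h, u, hu1, hu.epiConverges h⟩

end EpiLimit

end HypoSym

end

theorem corollary6p4 (n : ℕ) (hn : 1 ≤ n) (f : EuclideanSpace ℝ (Fin n) → ℝ)
    (hf : f ∈ HypoSym.LCc n) :
    MeasureTheory.Integrable f ∧
    (∃ g : EuclideanSpace ℝ (Fin n) → ℝ, HypoSym.IsHypoSymmetrization f g) ∧
    ∀ g : EuclideanSpace ℝ (Fin n) → ℝ, HypoSym.IsHypoSymmetrization f g →
      MeasureTheory.Integrable g ∧ HypoSym.totalMass f ≤ HypoSym.totalMass g := by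
  obtain ⟨ψ, hψ, rfl⟩ := hf
  refine ⟨hψ.integrable_expNeg, ?_, ?_⟩
  · have : NeZero n := ⟨by lia⟩
    obtain ⟨φ, hφ⟩ := hψ.exists_isEpiSymmetrization
    exact ⟨HypoSym.expNeg φ, ψ, φ, hψ, rfl, hφ, rfl⟩
  · rintro g ⟨ψ', φ, hψ', hf, hφ, rfl⟩
    refine ⟨hφ.isConvC.integrable_expNeg, ?_⟩
    rw [hf]
    exact hφ.totalMass_le hψ'
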